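/- **Arithmetic regularity lemma for $U^3$.** Conventions. Write $\mathbb{E}_{x}$ for the average over a finite set. A *factor* on $\mathbb{F}_5^n$ is the $\sigma$-algebra generated by finitely many functions $\phi_1,\dots,\phi_k:\mathbb{F}_5^n\to\mathbb{F}_5$; its atoms are the non-empty sets $\{x:\phi_1(x)=c_1,\dots,\phi_k(x)=c_k\}$. A factor $\mathcal{B}'$ *refines* $\mathcal{B}$ if every atom of $\mathcal{B}'$ is contained in an atom of $\mathcal{B}$. For $f:\mathbb{F}_5^n\to\mathbb{R}$, $\mathbb{E}(f|\mathcal{B})(x)$ is the average of $f$ over the atom of $\mathcal{B}$ containing $x$. A *quadratic factor of complexity $(d_1,d_2)$* is a pair $(\mathcal{B}_1,\mathcal{B}_2)$ for which there are vectors $r_1,\dots,r_{d_1}\in\mathbb{F}_5^n$ and symmetric $n\times n$ matrices $M_1,\dots,M_{d_2}$ over $\mathbb{F}_5$ such that $\mathcal{B}_1$ is generated by the functions $r_j^Tx$, and $\mathcal{B}_2$ by the functions $r_j^Tx$ and $x^TM_jx$. It has complexity *at most* $(d_1,d_2)$ if it has complexity $(k_1,k_2)$ for some $k_1\le d_1$,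 $k_2\le d_2$. A quadratic factor $(\mathcal{B}_1,\mathcal{B}_2)$ refines another $(\mathcal{B}^{(0)}_1,\mathcal{B}^{(0)}_2)$ if $\mathcal{B}_i$ refines $\mathcal{B}_i^{(0)}$ for $i=1,2$. Finally $\Vert g\Vert_2=(\mathbb{E}_x g(x)^2)^{1/2}$ and \[ \Vert g\Vert_{U^3}^8=\mathbb{E}_{x,h_1,h_2,h_3\in\mathbb{F}_5^n}\ \prod_{S\subseteq\{1,2,3\}} g\Big(x+\sum_{i\in S}h_i\Big),\qquad \Vert g\Vert_{U^3}\ge 0.\] Statement. Let $\delta>0$, let $\omega:[0,\infty)\to(0,\infty)$ be an arbitrary function (a "growth function", which may depend on $\delta$), and let $d^{(0)}_1,d^{(0)}_2\ge 0$ be integers. Then there is a constant $C=C(\delta,\omega,d^{(0)}_1,d^{(0)}_2)$ such that the following holds for every $n\ge 0$, every $f:\mathbb{F}_5^n\to[-1,1]$ and every quadratic factor $(\mathcal{B}^{(0)}_1,\mathcal{B}^{(0)}_2)$ on $\mathbb{F}_5^n$ of complexity $(d^{(0)}_1,d^{(0)}_2)$. There are an integer $0\le d\le C$, a quadratic factor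 $(\mathcal{B}_1,\mathcal{B}_2)$ of complexity at most $(d,d)$ which refines $(\mathcal{B}^{(0)}_1,\mathcal{B}^{(0)}_2)$, and a decomposition $f=f_1+f_2+f_3$ with \[ f_1=\mathbb{E}(f|\mathcal{B}_2),\qquad \Vert f_2\Vert_2\le\delta,\qquad \Vert f_3\Vert_{U^3}\le\frac1{\omega(d)}.\] -/

import Mathlib

open Finset BigOperators

noncomputable section

namespace QuadFourier

/-- The vector space `𝔽₅ⁿ`. -/
abbrev V (n : ℕ) : Type := Fin n → ZMod 5

/-- The factor (σ-algebra) generated by a family of functions `φ i : 𝔽₅ⁿ → 𝔽₅`. -/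
def generatedFactor {n : ℕ} {ι : Type} (φ : ι → V n → ZMod 5) : MeasurableSpace (V n) :=
  ⨆ i, MeasurableSpace.comap (φ i) ⊤

/-- The atom of the factor `B` which contains `x`. -/
def atom {n : ℕ} (B : MeasurableSpace (V n)) (x : V n) : Set (V n) :=
  @measurableAtom (V n) B x

/-- The atoms of a generated factor are the joint level sets of the generating functions. -/
theorem atom_generatedFactor {n : ℕ} {ι : Type} (φ : ι → V n → ZMod 5) (x : V n) :
    atom (generatedFactor φ) x = {y | ∀ i, φ i y = φ i x} := by
  apply Set.Subset.antisymm
  · intro y hy i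
    have h := Set.mem_iInter₂.1 hy (φ i ⁻¹' {φ i x}) rfl
    refine Set.mem_iInter.1 h ?_
    exact MeasurableSpace.le_def.1 (le_iSup (fun i => MeasurableSpace.comap (φ i) ⊤) i) _
      ⟨{φ i x}, trivial, rfl⟩
  · intro y hy
    have hle : generatedFactor φ ≤
        MeasurableSpace.comap (fun (z : V n) (i : ι) => φ i z) ⊤ := by
      refine iSup_le fun i => ?_
      rintro _ ⟨s, -, rfl⟩
      exact ⟨{g | g i ∈ s}, trivial, rfl⟩
    refine Set.mem_iInter₂.2 fun s hx => Set.mem_iInter.2 fun hs => ?_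
    obtain ⟨t, -, rfl⟩ := hle s hs
    have heq : (fun i => φ i y) = fun i => φ i x := funext hy
    change (fun i => φ i y) ∈ t
    rw [heq]
    exact hx

/-- `B'` refines `B`: every atom of `B'` is contained in an atom of `B`. -/
def Refines {n : ℕ} (B' B : MeasurableSpace (V n)) : Prop :=
  ∀ x, ∃ y, atom B' x ⊆ atom B y

open Classical in
/-- The conditional expectation `𝔼(f | B)`: its value at `x` is the average of `f` over the
atom of `B` which contains `x`. -/
def condExpect {n : ℕ} (f : V n → ℝ) (B : MeasurableSpace (V n)) (x : V n) : ℝ :=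
  𝔼 y ∈ univ.filter (fun y => y ∈ atom B x), f y

/-- `(B₁, B₂)` is a (homogeneous) quadratic factor of complexity `(d₁, d₂)`: for some vectors
`r₁, …, r_{d₁}` and symmetric matrices `M₁, …, M_{d₂}`, the σ-algebra `B₁` is generated by the
linear forms `rⱼᵀ x`, and `B₂` by these together with the quadratic forms `xᵀ Mⱼ x`. -/
def IsQuadraticFactor {n : ℕ} (B₁ B₂ : MeasurableSpace (V n)) (d₁ d₂ : ℕ) : Prop :=
  ∃ (r : Fin d₁ → V n) (M : Fin d₂ → Matrix (Fin n) (Fin n) (ZMod 5)),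
    (∀ j, (M j).IsSymm) ∧
    B₁ = generatedFactor (fun j x => r j ⬝ᵥ x) ∧
    B₂ = generatedFactor
      (Sum.elim (fun j x => r j ⬝ᵥ x) (fun j x => x ⬝ᵥ (M j).mulVec x))

/-- `(B₁, B₂)` is a quadratic factor of complexity at most `(d₁, d₂)`. -/
def IsQuadraticFactorAtMost {n : ℕ} (B₁ B₂ : MeasurableSpace (V n)) (d₁ d₂ : ℕ) : Prop :=
  ∃ k₁ ≤ d₁, ∃ k₂ ≤ d₂, IsQuadraticFactor B₁ B₂ k₁ k₂

/-- The `L²` norm with respect to the uniform probability measure on `𝔽₅ⁿ`. -/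
def l2Norm {n : ℕ} (f : V n → ℝ) : ℝ := Real.sqrt (𝔼 x, f x ^ 2)

/-- The Gowers `U³` norm. -/
def u3Norm {n : ℕ} (f : V n → ℝ) : ℝ :=
  (𝔼 x, 𝔼 h₁, 𝔼 h₂, 𝔼 h₃,
    f x * f (x + h₁) * f (x + h₂) * f (x + h₃) *
      f (x + h₁ + h₂) * f (x + h₁ + h₃) * f (x + h₂ + h₃) *
      f (x + h₁ + h₂ + h₃)) ^ (1 / 8 : ℝ)

end QuadFourier

end

/-!
Refining `B` to `B'` raises the energy `𝔼 x, 𝔼(f | B)(x) ^ 2` by the squared `L²` distance between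
the two conditional expectations, and the energy of a bounded function never exceeds `1`. If
`f - 𝔼(f | B)` has large `U³` norm, the inverse theorem makes it correlate with a quadratic phase,
and adjoining this phase to `B` raises the energy by a fixed amount; so boundedly many steps lead to
a refinement `D` for which `f - 𝔼(f | D)` is as uniform as desired. Iterating this with uniformity
`1 / ω d` at a factor of complexity `d`, at some stage `𝔼(f | D) - 𝔼(f | B)` has `L²` norm at most
`δ`.

For the inverse theorem on a finite elementary abelian `p`-group `G`, `p ≠ 2`, consider the
ambiguity function `F (h, χ) = ‖(Δ_h f)^(χ)‖ ^ 2` on `G × Ĝ`. It is its own Fourier transform up to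
normalisation, hence positive definite, and its `ℓ²` norm is controlled below by the `U³` norm of
`f`. Positive definiteness forces the large values of `F` to have many additive coincidences, so
that the Balog–Szemerédi–Gowers and Freiman theorems place much of the mass of `F` on a subgroup of
size `O(#G)`, and then, after discarding a bounded index, on the graph of a homomorphism
`T : G → Ĝ`. Expanding the mass on this graph as a bilinear average against `Tᵗ - T` shows that `T`
is symmetric on a subgroup of bounded index. As translates of a subgroup carry no more mass of `F`
than the subgroup itself, `T` may be replaced by a symmetric bicharacter `2 B`. Then
`x ↦ f x * conj (B x x)` has large `U²` norm, and so correlates with a character.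
-/

noncomputable section

namespace QuadFourier

open scoped ComplexConjugate

/-! ### Fourier analysis on a finite abelian group -/

section Fourier

variable {G : Type*} [AddCommGroup G] [Fintype G]

/-- The Fourier coefficient of `g` at the character `χ`, normalised by averaging over `G`. -/
def fourierCoeff (g : G → ℂ) (χ : AddChar G ℂ) : ℂ := 𝔼 x, conj (χ x) * g x

/-- The multiplicative derivative `Δ_h f` of `f` in the direction `h`. -/
def mulDeriv {A : Type*} [Add A] (h : A) (f : A → ℂ) (x : A) : ℂ := f (x + h) * conj (f x)

theorem mulDeriv_comm {A : Type*} [AddCommGroup A] (h k : A) (f : A → ℂ) :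
    mulDeriv k (mulDeriv h f) = mulDeriv h (mulDeriv k f) := by
  ext x
  simp only [mulDeriv, map_mul, Complex.conj_conj, add_right_comm x k h]
  ring

theorem norm_mulDeriv_le_one {A : Type*} [Add A] {f : A → ℂ} (hf : ∀ x, ‖f x‖ ≤ 1) (h x : A) :
    ‖mulDeriv h f x‖ ≤ 1 := by
  rw [mulDeriv, norm_mul, RCLike.norm_conj]
  exact mul_le_one₀ (hf _) (norm_nonneg _) (hf _)

theorem norm_expect_sq_le {ι : Type*} [Fintype ι] (F : ι → ℂ) :
    ‖𝔼 i, F i‖ ^ 2 ≤ 𝔼 i, ‖F i‖ ^ 2 := by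
  cases isEmpty_or_nonempty ι
  · simp
  calc ‖𝔼 i, F i‖ ^ 2 ≤ (𝔼 i, 1 * ‖F i‖) ^ 2 := by
        simp only [one_mul]
        gcongr
        exact RCLike.norm_expect_le (K := ℂ)
    _ ≤ (𝔼 _i : ι, 1 ^ 2) * 𝔼 i, ‖F i‖ ^ 2 := expect_mul_sq_le_sq_mul_sq _ _ _
    _ = 𝔼 i, ‖F i‖ ^ 2 := by simp

theorem conj_expect {ι : Type*} [Fintype ι] (F : ι → ℂ) : conj (𝔼 i, F i) = 𝔼 i, conj (F i) :=
  map_expect (starLinearEquiv ℚ≥0 (A := ℂ)) F univ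

theorem norm_expect_sq_eq (F : G → ℂ) : (‖𝔼 x, F x‖ ^ 2 : ℂ) = 𝔼 k, 𝔼 x, mulDeriv k F x := by
  rw [← Complex.mul_conj', conj_expect, expect_comm, mul_expect]
  refine expect_congr rfl fun x _ => ?_
  rw [expect_mul]
  exact (Fintype.expect_equiv (Equiv.addLeft x) _ _ fun k => rfl).symm

theorem sum_fourierCoeff_mul_apply (g : G → ℂ) (k : G) :
    ∑ χ : AddChar G ℂ, fourierCoeff g χ * χ k = g k := by
  classical
  calc ∑ χ : AddChar G ℂ, fourierCoeff g χ * χ k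
      = 𝔼 x, (∑ χ : AddChar G ℂ, χ (k - x)) * g x := by
        simp only [fourierCoeff, expect_mul, sum_mul]
        rw [expect_sum_comm]
        refine sum_congr rfl fun χ _ => expect_congr rfl fun x _ => ?_
        rw [sub_eq_add_neg, AddChar.map_add_eq_mul, AddChar.map_neg_eq_conj]
        ring
    _ = g k := by
        simp only [AddChar.sum_apply_eq_ite, sub_eq_zero, ite_mul, zero_mul]
        rw [Fintype.expect_eq_sum_div_card, sum_ite_eq, if_pos (mem_univ k),
          mul_div_cancel_left₀ _ (by simp)]

theorem fourierCoeff_expect_mulDeriv (g : G → ℂ) (χ : AddChar G ℂ) :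
    fourierCoeff (fun k => 𝔼 x, mulDeriv k g x) χ = ‖fourierCoeff g χ‖ ^ 2 := by
  simp only [fourierCoeff, norm_expect_sq_eq, mul_expect]
  refine expect_congr rfl fun k _ => expect_congr rfl fun x _ => ?_
  have hχ : χ x * conj (χ x) = 1 := by simp [Complex.mul_conj']
  simp only [mulDeriv, map_mul, AddChar.map_add_eq_mul, Complex.conj_conj]
  linear_combination (-conj (χ k) * g (x + k) * conj (g x)) * hχ

theorem sum_norm_sq_fourierCoeff_mul_apply (g : G → ℂ) (k : G) :
    ∑ χ : AddChar G ℂ, (‖fourierCoeff g χ‖ ^ 2 : ℂ) * χ k = 𝔼 x, mulDeriv k g x := by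
  simp only [← fourierCoeff_expect_mulDeriv]
  exact sum_fourierCoeff_mul_apply (fun k => 𝔼 x, mulDeriv k g x) k

theorem sum_norm_sq_fourierCoeff (g : G → ℂ) :
    ∑ χ : AddChar G ℂ, ‖fourierCoeff g χ‖ ^ 2 = 𝔼 x, ‖g x‖ ^ 2 := by
  have h := sum_norm_sq_fourierCoeff_mul_apply g 0
  simp only [AddChar.map_zero_eq_one, mul_one, mulDeriv, add_zero, Complex.mul_conj'] at h
  exact_mod_cast h

theorem sum_norm_fourierCoeff_pow_four (g : G → ℂ) :
    ∑ χ : AddChar G ℂ, ‖fourierCoeff g χ‖ ^ 4 = 𝔼 k, ‖𝔼 x, mulDeriv k g x‖ ^ 2 := by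
  rw [← sum_norm_sq_fourierCoeff]
  refine sum_congr rfl fun χ _ => ?_
  rw [fourierCoeff_expect_mulDeriv, norm_pow, Complex.norm_real, norm_norm, ← pow_mul]

end Fourier

/-! ### Positive definite functions -/

section IsPosDef

variable {A : Type*} [AddCommGroup A] {F : A → ℝ}

/-- `F` is positive definite: the kernel `(u, v) ↦ F (u - v)` is positive semidefinite. -/
def IsPosDef (F : A → ℝ) : Prop := (Matrix.of fun u v => F (u - v)).PosSemidef

theorem isPosDef_of_eq_sum_mul_conj {ι : Type*} [Fintype ι] {c : ι → ℝ} (hc : ∀ i, 0 ≤ c i)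
    {s : ι → A → ℂ} (hF : ∀ u v, (F (u - v) : ℂ) = ∑ i, c i * (s i u * conj (s i v))) :
    IsPosDef F := by
  refine ⟨Matrix.IsHermitian.ext fun u v => ?_, fun a => ?_⟩
  · have hsymm : (F (v - u) : ℂ) = F (u - v) := by
      rw [← Complex.conj_ofReal, hF v u, hF u v]
      simp [mul_comm]
    simpa using mod_cast hsymm
  · have hsq : (∑ u ∈ a.support, ∑ v ∈ a.support, a u * F (u - v) * a v : ℂ) =
        ∑ i, c i * (‖∑ u ∈ a.support, a u * s i u‖ : ℂ) ^ 2 := by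
      simp only [hF, ← Complex.mul_conj', map_sum, map_mul, Complex.conj_ofReal]
      simp only [sum_mul_sum]
      simp only [mul_sum, sum_mul]
      rw [sum_comm_cycle]
      refine sum_congr rfl fun i _ => sum_congr rfl fun u _ => sum_congr rfl fun v _ => ?_
      ring
    have hreal : ∑ u ∈ a.support, ∑ v ∈ a.support, a u * F (u - v) * a v =
        ∑ i, c i * ‖∑ u ∈ a.support, (a u * s i u : ℂ)‖ ^ 2 := mod_cast hsq
    simp only [Finsupp.sum, star_trivial, Matrix.of_apply, hreal]
    exact sum_nonneg fun i _ => mul_nonneg (hc i) (sq_nonneg _)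

theorem IsPosDef.map_neg (hF : IsPosDef F) (v : A) : F (-v) = F v := by
  simpa using hF.isHermitian.apply v 0

theorem IsPosDef.sum_sum_mul_nonneg (hF : IsPosDef F) {ι : Type*} [Fintype ι] (x : ι → A)
    (c : ι → ℝ) : 0 ≤ ∑ i, ∑ j, c i * c j * F (x i - x j) := by
  have h := (hF.submatrix x).dotProduct_mulVec_nonneg c
  simpa [dotProduct, Matrix.mulVec, mul_sum, mul_assoc, mul_comm, mul_left_comm] using h

theorem IsPosDef.sum_coset_le (hF : IsPosDef F) {H : Type*} [AddCommGroup H] [Fintype H]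
    (φ : H →+ A) (v : A) : ∑ h, F (v + φ h) ≤ ∑ h, F (φ h) := by
  -- Test positive definiteness on the function `1_{φ H} - 1_{v + φ H}`.
  have hnonneg := hF.sum_sum_mul_nonneg (Sum.elim φ fun h => v + φ h)
    (Sum.elim (fun _ => (1 : ℝ)) fun _ => -1)
  have hsum (w : A) (h : H) : ∑ h', F (w + φ h - φ h') = ∑ h', F (w + φ h') := by
    rw [← (Equiv.subLeft h).sum_comp fun h' => F (w + φ h')]
    simp [add_sub_assoc]
  have hflip (h h' : H) : F (φ h - (v + φ h')) = F (v + φ h' - φ h) := by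
    rw [← hF.map_neg, neg_sub]
  have hzero (h : H) : ∑ h', F (φ h - φ h') = ∑ h', F (φ h') := by
    simpa using hsum 0 h
  simp only [Fintype.sum_sum_type, Sum.elim_inl, Sum.elim_inr, add_sub_add_left_eq_sub, hzero,
    hsum, one_mul, mul_one, neg_mul, mul_neg, sum_neg_distrib, hflip,
    sum_add_distrib, sum_const, nsmul_eq_mul] at hnonneg
  rw [sum_comm] at hnonneg
  simp only [hsum, sum_const, nsmul_eq_mul] at hnonneg
  have hcard : (0 : ℝ) < #(univ : Finset H) := by exact_mod_cast card_pos.2 univ_nonempty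
  nlinarith

theorem IsPosDef.sq_sum_le (hF : IsPosDef F) {ι : Type*} [Fintype ι] (x : ι → A) :
    (∑ i, F (x i)) ^ 2 ≤ F 0 * ∑ i, ∑ j, F (x i - x j) := by
  have hquad (t : ℝ) : 0 ≤ F 0 * (t * t) + -2 * (∑ i, F (x i)) * t
      + ∑ i, ∑ j, F (x i - x j) := by
    have h := hF.sum_sum_mul_nonneg (fun o : Option ι => o.elim 0 x) fun o => o.elim (-t) fun _ => 1
    simp only [Fintype.sum_option, Option.elim, zero_sub, sub_zero, hF.map_neg, mul_one, one_mul,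
      sum_add_distrib, ← mul_sum] at h
    linarith
  have := discrim_le_zero hquad
  rw [discrim] at this
  linarith

end IsPosDef

/-! ### The ambiguity function -/

section Ambiguity

variable {G : Type*} [AddCommGroup G] [Fintype G]

/-- The ambiguity function of `f`: the squared Fourier coefficients of its derivatives. -/
def ambiguity (f : G → ℂ) (v : G × AddChar G ℂ) : ℝ := ‖fourierCoeff (mulDeriv v.1 f) v.2‖ ^ 2

theorem ambiguity_nonneg (f : G → ℂ) (v : G × AddChar G ℂ) : 0 ≤ ambiguity f v := sq_nonneg _

theorem sum_ambiguity_fiber_le_one {f : G → ℂ} (hf : ∀ x, ‖f x‖ ≤ 1) (h : G) :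
    ∑ χ, ambiguity f (h, χ) ≤ 1 := by
  simp only [ambiguity, sum_norm_sq_fourierCoeff]
  exact expect_le univ_nonempty fun x _ =>
    pow_le_one₀ (norm_nonneg _) (norm_mulDeriv_le_one hf h x)

theorem ambiguity_le_one {f : G → ℂ} (hf : ∀ x, ‖f x‖ ≤ 1) (v : G × AddChar G ℂ) :
    ambiguity f v ≤ 1 :=
  (single_le_sum (f := fun χ => ambiguity f (v.1, χ)) (fun _ _ => ambiguity_nonneg f _)
    (mem_univ v.2)).trans (sum_ambiguity_fiber_le_one hf v.1)

theorem sum_ambiguity_le_card {f : G → ℂ} (hf : ∀ x, ‖f x‖ ≤ 1) :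
    ∑ v, ambiguity f v ≤ Fintype.card G := by
  rw [Fintype.sum_prod_type]
  exact (sum_le_sum fun h _ => sum_ambiguity_fiber_le_one hf h).trans (by simp)

theorem ambiguity_self_dual (f : G → ℂ) (h : G) (χ : AddChar G ℂ) :
    (ambiguity f (h, χ) : ℂ) = 𝔼 k, ∑ ψ, ambiguity f (k, ψ) * (ψ h * conj (χ k)) := by
  have hfiber (k : G) : ∑ ψ, ambiguity f (k, ψ) * (ψ h * conj (χ k)) =
      conj (χ k) * 𝔼 x, mulDeriv k (mulDeriv h f) x := by
    rw [mulDeriv_comm, ← sum_norm_sq_fourierCoeff_mul_apply, mul_sum]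
    refine sum_congr rfl fun ψ _ => ?_
    push_cast [ambiguity]
    ring
  simp only [hfiber]
  rw [ambiguity, Complex.ofReal_pow, ← fourierCoeff_expect_mulDeriv, fourierCoeff]

theorem isPosDef_ambiguity (f : G → ℂ) : IsPosDef (ambiguity f) := by
  refine isPosDef_of_eq_sum_mul_conj (c := fun w => ambiguity f w / Fintype.card G)
    (s := fun w u => w.2 u.1 * conj (u.2 w.1))
    (fun w => div_nonneg (ambiguity_nonneg f w) (Nat.cast_nonneg _)) fun u v => ?_
  rw [← Prod.mk.eta (p := u - v), ambiguity_self_dual, Fintype.expect_eq_sum_div_card, sum_div,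
    Fintype.sum_prod_type]
  refine sum_congr rfl fun k _ => ?_
  rw [sum_div]
  refine sum_congr rfl fun ψ _ => ?_
  simp only [sub_eq_add_neg, Prod.fst_add, Prod.snd_add, Prod.fst_neg, Prod.snd_neg,
    AddChar.map_add_eq_mul, AddChar.map_neg_eq_conj, AddChar.add_apply, AddChar.neg_apply,
    map_mul, Complex.conj_conj]
  push_cast
  ring

/-- The eighth power of the Gowers `U³` norm. The two innermost averages over parallelepipeds
are written as a square, which makes the value real. -/
def u3Pow (f : G → ℂ) : ℝ := 𝔼 h, 𝔼 k, ‖𝔼 x, mulDeriv k (mulDeriv h f) x‖ ^ 2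

theorem u3Pow_eq_expect_sum_ambiguity_sq (f : G → ℂ) :
    u3Pow f = 𝔼 h, ∑ χ, ambiguity f (h, χ) ^ 2 := by
  simp only [u3Pow, ← sum_norm_fourierCoeff_pow_four, ambiguity, ← pow_mul]

end Ambiguity

/-! ### The Balog–Szemerédi–Gowers theorem -/

section DependentRandomChoice

variable {α : Type*} (S : Finset α) (r : α → α → Prop) [DecidableRel r]

/-- The number of common neighbours in `S` of `a` and `b`, in the graph with adjacency `r`. -/
def codegree (a b : α) : ℕ := #{u ∈ S | r a u ∧ r b u}

theorem sum_card_filter_neighbor_pairs (p : α × α → Prop) [DecidablePred p] :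
    ∑ u ∈ S, #{q ∈ {a ∈ S | r a u} ×ˢ {a ∈ S | r a u} | p q} =
      ∑ q ∈ S ×ˢ S with p q, codegree S r q.1 q.2 := by
  refine Eq.trans (sum_congr rfl fun u _ => congrArg card ?_)
    (sum_card_bipartiteAbove_eq_sum_card_bipartiteBelow fun u (q : α × α) => r q.1 u ∧ r q.2 u)
  ext q
  simp only [bipartiteAbove, mem_filter, mem_product]
  tauto

variable {S r} {δ : ℝ}

theorem sq_mul_card_pow_three_le_sum_card_sq (hδ : 0 ≤ δ) (hS : S.Nonempty)
    (hr : δ * (#S : ℝ) ^ 2 ≤ ∑ u ∈ S, (#{a ∈ S | r a u} : ℝ)) :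
    δ ^ 2 * (#S : ℝ) ^ 3 ≤ ∑ u ∈ S, (#{a ∈ S | r a u} : ℝ) ^ 2 := by
  have hcard : (0 : ℝ) < #S := by exact_mod_cast hS.card_pos
  refine le_of_mul_le_mul_left ?_ hcard
  calc (#S : ℝ) * (δ ^ 2 * (#S : ℝ) ^ 3) = (δ * (#S : ℝ) ^ 2) ^ 2 := by ring
    _ ≤ (∑ u ∈ S, (#{a ∈ S | r a u} : ℝ)) ^ 2 := by gcongr
    _ ≤ _ := sq_sum_le_card_mul_sum_sq

theorem exists_neighborhood_few_sparse_pairs (hδ : 0 < δ) (hS : S.Nonempty)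
    (hr : δ * (#S : ℝ) ^ 2 ≤ ∑ u ∈ S, (#{a ∈ S | r a u} : ℝ)) :
    ∃ A ⊆ S, δ / 2 * #S ≤ #A ∧
      (#{q ∈ A ×ˢ A | (codegree S r q.1 q.2 : ℝ) < δ ^ 2 / 16 * #S} : ℝ) ≤ (#A : ℝ) ^ 2 / 8 := by
  let N (u : α) : Finset α := {a ∈ S | r a u}
  let sparse (q : α × α) : Prop := (codegree S r q.1 q.2 : ℝ) < δ ^ 2 / 16 * #S
  have hsq : δ ^ 2 * (#S : ℝ) ^ 3 ≤ ∑ u ∈ S, (#(N u) : ℝ) ^ 2 :=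
    sq_mul_card_pow_three_le_sum_card_sq hδ.le hS hr
  have hsparse : ∑ u ∈ S, (#{q ∈ N u ×ˢ N u | sparse q} : ℝ) ≤ δ ^ 2 / 16 * (#S : ℝ) ^ 3 := by
    calc ∑ u ∈ S, (#{q ∈ N u ×ˢ N u | sparse q} : ℝ)
        = ∑ q ∈ S ×ˢ S with sparse q, (codegree S r q.1 q.2 : ℝ) := by
          exact_mod_cast sum_card_filter_neighbor_pairs S r sparse
      _ ≤ #{q ∈ S ×ˢ S | sparse q} • (δ ^ 2 / 16 * (#S : ℝ)) :=
          sum_le_card_nsmul _ _ _ fun q hq => (mem_filter.1 hq).2.le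
      _ ≤ #(S ×ˢ S) • (δ ^ 2 / 16 * (#S : ℝ)) := by
          gcongr
          exact filter_subset _ _
      _ = δ ^ 2 / 16 * (#S : ℝ) ^ 3 := by
          rw [card_product, nsmul_eq_mul]
          push_cast
          ring
  obtain ⟨u, -, hu⟩ : ∃ u ∈ S, δ ^ 2 / 2 * (#S : ℝ) ^ 2 ≤
      (#(N u) : ℝ) ^ 2 - 8 * #{q ∈ N u ×ˢ N u | sparse q} := by
    refine exists_le_of_sum_le hS ?_
    rw [sum_const, nsmul_eq_mul, sum_sub_distrib, ← mul_sum]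
    nlinarith
  refine ⟨N u, filter_subset _ _, ?_, ?_⟩
  · refine le_of_sq_le_sq ?_ (Nat.cast_nonneg _)
    nlinarith [sq_nonneg (δ * (#S : ℝ))]
  · nlinarith [sq_nonneg (δ * (#S : ℝ))]

theorem half_card_le_card_filter_of_few_pairs {A : Finset α} {p : α → α → Prop} [DecidableRel p]
    (hp : (#{q ∈ A ×ˢ A | p q.1 q.2} : ℝ) ≤ (#A : ℝ) ^ 2 / 8) :
    (#A : ℝ) / 2 ≤ #{a ∈ A | (#{b ∈ A | p a b} : ℝ) ≤ #A / 4} := by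
  rcases A.eq_empty_or_nonempty with rfl | hA
  · simp
  have hcard : (0 : ℝ) < #A := by exact_mod_cast hA.card_pos
  let bad : Finset α := {a ∈ A | ¬ (#{b ∈ A | p a b} : ℝ) ≤ #A / 4}
  have hmarkov : (#bad : ℝ) * (#A / 4) ≤ (#A : ℝ) ^ 2 / 8 := by
    calc (#bad : ℝ) * (#A / 4) ≤ ∑ a ∈ bad, (#{b ∈ A | p a b} : ℝ) := by
          rw [← nsmul_eq_mul]
          exact card_nsmul_le_sum _ _ _ fun a ha => (not_le.1 (mem_filter.1 ha).2).le
      _ ≤ ∑ a ∈ A, (#{b ∈ A | p a b} : ℝ) :=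
          sum_le_sum_of_subset_of_nonneg (filter_subset _ _) fun _ _ _ => Nat.cast_nonneg _
      _ = #{q ∈ A ×ˢ A | p q.1 q.2} := by
          simp only [card_filter, sum_product, Nat.cast_sum]
      _ ≤ (#A : ℝ) ^ 2 / 8 := hp
  have hbad : (#bad : ℝ) ≤ #A / 2 := by
    by_contra! h
    nlinarith
  have hsplit : (#{a ∈ A | (#{b ∈ A | p a b} : ℝ) ≤ #A / 4} : ℝ) + #bad = #A := by
    exact_mod_cast card_filter_add_card_filter_not _
  linarith

theorem exists_subset_many_length_four_paths (hδ : 0 < δ) (hS : S.Nonempty)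
    (hr : δ * (#S : ℝ) ^ 2 ≤ ∑ u ∈ S, (#{a ∈ S | r a u} : ℝ)) :
    ∃ A ⊆ S, δ / 4 * #S ≤ #A ∧ ∀ a ∈ A, ∀ a' ∈ A, δ / 4 * #S ≤
      #{b ∈ S | δ ^ 2 / 16 * #S ≤ codegree S r a b ∧ δ ^ 2 / 16 * #S ≤ codegree S r a' b} := by
  classical
  obtain ⟨A, hAS, hA, hpairs⟩ := exists_neighborhood_few_sparse_pairs hδ hS hr
  let sparse (a b : α) : Prop := (codegree S r a b : ℝ) < δ ^ 2 / 16 * #S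
  let A' : Finset α := {a ∈ A | (#{b ∈ A | sparse a b} : ℝ) ≤ #A / 4}
  have hA' : (#A : ℝ) / 2 ≤ #A' := half_card_le_card_filter_of_few_pairs hpairs
  refine ⟨A', (filter_subset _ _).trans hAS, by linarith, fun a ha a' ha' => ?_⟩
  have hcover : A ⊆ ({b ∈ A | sparse a b} ∪ {b ∈ A | sparse a' b}) ∪
      {b ∈ S | δ ^ 2 / 16 * #S ≤ codegree S r a b ∧ δ ^ 2 / 16 * #S ≤ codegree S r a' b} := by
    intro b hb
    simp only [sparse, mem_union, mem_filter, hb, hAS hb, true_and, ← not_lt]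
    tauto
  have hcard := (card_le_card hcover).trans ((card_union_le _ _).trans
    (Nat.add_le_add_right (card_union_le _ _) _))
  have hcard' : (#A : ℝ) ≤ #{b ∈ A | sparse a b} + #{b ∈ A | sparse a' b} +
      #{b ∈ S | δ ^ 2 / 16 * #S ≤ codegree S r a b ∧ δ ^ 2 / 16 * #S ≤ codegree S r a' b} := by
    exact_mod_cast hcard
  linarith [(mem_filter.1 ha).2, (mem_filter.1 ha').2]

end DependentRandomChoice

section BalogSzemerediGowers

open scoped Pointwise

variable {G : Type*} [AddCommGroup G] [DecidableEq G]

/-- The quadruples of elements of `P` with sum `d`. -/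
def quadruplesWithSum (P : Finset G) (d : G) : Finset (G × G × G × G) :=
  {p ∈ P ×ˢ P ×ˢ P ×ˢ P | p.1 + p.2.1 + p.2.2.1 + p.2.2.2 = d}

theorem sum_card_quadruplesWithSum_le (P D : Finset G) :
    ∑ d ∈ D, #(quadruplesWithSum P d) ≤ #P ^ 4 := by
  calc ∑ d ∈ D, #(quadruplesWithSum P d)
      = #{p ∈ P ×ˢ P ×ˢ P ×ˢ P | p.1 + p.2.1 + p.2.2.1 + p.2.2.2 ∈ D} :=
        sum_card_fiberwise_eq_card_filter _ _ _
    _ ≤ #(P ×ˢ P ×ˢ P ×ˢ P) := card_filter_le _ _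
    _ = #P ^ 4 := by
        simp only [card_product]
        ring

theorem sum_codegree_mul_codegree_le {P : Finset G} (hP : ∀ x ∈ P, -x ∈ P) (S B : Finset G)
    (a a' : G) :
    ∑ b ∈ B, codegree S (fun x u => x - u ∈ P) a b * codegree S (fun x u => x - u ∈ P) a' b ≤
      #(quadruplesWithSum P (a - a')) := by
  let common (x y : G) : Finset G := {u ∈ S | x - u ∈ P ∧ y - u ∈ P}
  -- Telescope along the path `a, u, b, u', a'`.
  have hinj : #(B.sigma fun b => common a b ×ˢ common a' b) ≤
      #(quadruplesWithSum P (a - a')) := by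
    refine card_le_card_of_injOn
      (fun q => (a - q.2.1, q.2.1 - q.1, q.1 - q.2.2, q.2.2 - a')) ?_ ?_
    · rintro ⟨b, u, u'⟩ hq
      simp only [common, coe_sigma, Set.mem_sigma_iff, mem_coe, mem_product, mem_filter] at hq
      obtain ⟨-, ⟨-, hau, hbu⟩, -, hau', hbu'⟩ := hq
      have hub := hP _ hbu
      have hua' := hP _ hau'
      rw [neg_sub] at hub hua'
      simp [quadruplesWithSum, hau, hub, hbu', hua']
    · rintro ⟨b, u, u'⟩ - ⟨c, w, w'⟩ - h
      simp only [Prod.mk.injEq] at h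
      obtain ⟨hu, hb, hu', -⟩ := h
      obtain rfl : u = w := sub_right_injective hu
      obtain rfl : b = c := sub_right_injective hb
      obtain rfl : u' = w' := sub_right_injective hu'
      rfl
  simpa only [card_sigma, card_product, common, codegree] using hinj

theorem balog_szemeredi_gowers {S P : Finset G} (hS : S.Nonempty) (hP : ∀ x ∈ P, -x ∈ P)
    {δ L : ℝ} (hδ : 0 < δ) (hr : δ * (#S : ℝ) ^ 2 ≤ ∑ u ∈ S, (#{a ∈ S | a - u ∈ P} : ℝ))
    (hL : (#P : ℝ) ≤ L * #S) :
    ∃ A ⊆ S, δ / 4 * #S ≤ #A ∧ (#(A - A) : ℝ) ≤ 4096 * L ^ 4 / δ ^ 6 * #A := by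
  obtain ⟨A, hAS, hA, hpaths⟩ := exists_subset_many_length_four_paths hδ hS hr
  have : (0 : ℝ) < #S := by exact_mod_cast hS.card_pos
  refine ⟨A, hAS, hA, ?_⟩
  have hquad : ∀ d ∈ A - A,
      δ / 4 * #S * (δ ^ 2 / 16 * #S) ^ 2 ≤ (#(quadruplesWithSum P d) : ℝ) := by
    intro d hd
    obtain ⟨a, ha, a', ha', rfl⟩ := mem_sub.1 hd
    refine le_trans ?_ (Nat.cast_le.2 (sum_codegree_mul_codegree_le hP S {b ∈ S |
      δ ^ 2 / 16 * #S ≤ codegree S (fun x u => x - u ∈ P) a b ∧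
        δ ^ 2 / 16 * #S ≤ codegree S (fun x u => x - u ∈ P) a' b} a a'))
    refine (mul_le_mul_of_nonneg_right (hpaths a ha a' ha') (sq_nonneg _)).trans ?_
    rw [← nsmul_eq_mul, Nat.cast_sum]
    refine card_nsmul_le_sum _ _ _ fun b hb => ?_
    obtain ⟨-, hab, hab'⟩ := mem_filter.1 hb
    rw [Nat.cast_mul, sq]
    exact mul_le_mul hab hab' (by positivity) (Nat.cast_nonneg _)
  have hcount : (#(A - A) : ℝ) * (δ / 4 * #S * (δ ^ 2 / 16 * #S) ^ 2) ≤ (L * #S) ^ 4 := by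
    rw [← nsmul_eq_mul]
    refine (card_nsmul_le_sum _ _ _ hquad).trans ?_
    refine le_trans ?_ (pow_le_pow_left₀ (Nat.cast_nonneg _) hL 4)
    exact_mod_cast sum_card_quadruplesWithSum_le P (A - A)
  calc (#(A - A) : ℝ) ≤ 1024 * L ^ 4 / δ ^ 5 * #S := by
        rw [div_mul_eq_mul_div, le_div_iff₀ (by positivity)]
        refine le_of_mul_le_mul_right (a := (#S : ℝ) ^ 3) ?_ (by positivity)
        nlinarith
    _ = 4096 * L ^ 4 / δ ^ 6 * (δ / 4 * #S) := by field_simp; ring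
    _ ≤ _ := by gcongr

end BalogSzemerediGowers

/-! ### Freiman's theorem in modules over a finite ring -/

section Freiman

open scoped Pointwise

variable {R G : Type*} [Ring R] [AddCommGroup G] [Module R G]

theorem natCard_span_finset_le [Finite R] (X : Finset G) :
    Nat.card (Submodule.span R (X : Set G)) ≤ Nat.card R ^ #X := by
  have hsurj : Function.Surjective
      (Fintype.linearCombination R (Subtype.val : X → G)).rangeRestrict :=
    LinearMap.surjective_rangeRestrict _
  have hrange : LinearMap.range (Fintype.linearCombination R (Subtype.val : X → G)) =
      Submodule.span R (X : Set G) := by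
    rw [Fintype.range_linearCombination, Subtype.range_coe_subtype, setOfPred_mem]
  rw [← hrange]
  simpa [Nat.card_fun] using Nat.card_le_card_of_surjective _ hsurj

/-- The sumset `W + Y` as a subgroup, for a subgroup `W` and a symmetric set `Y ∋ 0` whose sumset
`Y + Y` is covered by the translates of `Y` by elements of `W`. -/
def coverSubgroup (W : AddSubgroup G) (Y : Set G) (hzero : 0 ∈ Y) (hneg : -Y = Y)
    (hadd : Y + Y ⊆ W + Y) : AddSubgroup G where
  carrier := W + Y
  zero_mem' := ⟨0, W.zero_mem, 0, hzero, add_zero 0⟩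
  add_mem' := by
    rintro _ _ ⟨w, hw, y, hy, rfl⟩ ⟨w', hw', y', hy', rfl⟩
    obtain ⟨x, hx, z, hz, h⟩ := hadd ⟨y, hy, y', hy', rfl⟩
    refine ⟨w + w' + x, W.add_mem (W.add_mem hw hw') hx, z, hz, ?_⟩
    simp only at h ⊢
    rw [add_add_add_comm, ← h, add_assoc]
  neg_mem' := by
    rintro _ ⟨w, hw, y, hy, rfl⟩
    exact ⟨-w, W.neg_mem hw, -y, by simpa [hneg] using Set.neg_mem_neg.2 hy, (neg_add w y).symm⟩

theorem natCard_coverSubgroup_le [Finite G] (W : AddSubgroup G) (Y : Set G) (hzero : 0 ∈ Y)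
    (hneg : -Y = Y) (hadd : Y + Y ⊆ W + Y) :
    Nat.card (coverSubgroup W Y hzero hneg hadd) ≤ Nat.card W * Nat.card Y := by
  rw [← Nat.card_prod]
  exact Nat.card_le_card_of_surjective
    (β := coverSubgroup W Y hzero hneg hadd)
    (fun p : W × Y => ⟨p.1 + p.2, p.1, p.1.2, p.2, p.2.2, rfl⟩)
    fun ⟨_, w, hw, y, hy, h⟩ => ⟨(⟨w, hw⟩, ⟨y, hy⟩), Subtype.ext h⟩

variable [DecidableEq G] {A : Finset G} {K : ℕ}

theorem exists_card_le_sub_add_sub_subset (hA : A.Nonempty) (hK : #(A - A) ≤ K * #A) :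
    ∃ X : Finset G, #X ≤ K ^ 5 ∧ (A - A) + (A - A) ⊆ X + (A - A) := by
  have hcard : (0 : ℚ≥0) < #A := by exact_mod_cast hA.card_pos
  have hdoubling : (#(A - A) : ℚ≥0) / #A ≤ K := by
    rw [div_le_iff₀ hcard]
    exact_mod_cast hK
  have hsum : (#((A - A) + (A - A) + A) : ℚ≥0) ≤ (K : ℚ≥0) ^ 5 * #A := by
    have hnsmul : (A - A) + (A - A) + A = 3 • A - 2 • A := by
      rw [sub_add_sub_comm, sub_add_eq_add_sub, ← two_nsmul, ← succ_nsmul]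
    rw [hnsmul]
    exact (pluennecke_ruzsa_inequality_nsmul_sub_nsmul_sub hA A 3 2).trans (by gcongr)
  obtain ⟨X, -, hX, hcover⟩ := ruzsa_covering_add (K := (K : ℝ) ^ 5) hA (by exact_mod_cast hsum)
  exact ⟨X, by exact_mod_cast hX, hcover⟩

theorem exists_addSubgroup_of_card_sub_le [Finite G] (R : Type*) [Ring R] [Finite R] [Module R G]
    (hA : A.Nonempty) (hK : #(A - A) ≤ K * #A) :
    ∃ H : AddSubgroup G, (∀ a ∈ A, ∀ b ∈ A, a - b ∈ H) ∧
      Nat.card H ≤ Nat.card R ^ K ^ 5 * (K * #A) := by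
  obtain ⟨X, hX, hcover⟩ := exists_card_le_sub_add_sub_subset hA hK
  let W : AddSubgroup G := (Submodule.span R (X : Set G)).toAddSubgroup
  let Y : Set G := ↑(A - A)
  have hzero : 0 ∈ Y := by
    obtain ⟨a, ha⟩ := hA
    exact mem_coe.2 (sub_self a ▸ sub_mem_sub ha ha)
  have hneg : -Y = Y := by simp [Y, neg_sub]
  have hadd : Y + Y ⊆ W + Y := by
    refine Set.Subset.trans ?_ (Set.add_subset_add_right (Submodule.subset_span (R := R)))
    simpa only [coe_add] using coe_subset.2 hcover
  refine ⟨coverSubgroup W Y hzero hneg hadd, fun a ha b hb =>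
    ⟨0, W.zero_mem, a - b, mem_coe.2 (sub_mem_sub ha hb), zero_add _⟩, ?_⟩
  refine (natCard_coverSubgroup_le W Y hzero hneg hadd).trans (Nat.mul_le_mul ?_ ?_)
  · exact (natCard_span_finset_le X).trans (Nat.pow_le_pow_right Nat.card_pos hX)
  · rwa [Nat.card_coe_set_eq, Set.ncard_coe_finset]

end Freiman

/-! ### Subgroups carrying a positive definite function -/

section SuperlevelSet

open scoped Classical in
/-- The set where `F` is at least `c`. For the ambiguity function this is a large spectrum. -/
def superlevelSet {A : Type*} [Fintype A] (F : A → ℝ) (c : ℝ) : Finset A := {v | c ≤ F v}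

variable {A : Type*} [Fintype A] {F : A → ℝ} {N c : ℝ}

theorem mem_superlevelSet {v : A} : v ∈ superlevelSet F c ↔ c ≤ F v := by
  simp [superlevelSet]

theorem mul_card_le_sum_of_subset_superlevelSet {S : Finset A} (hS : S ⊆ superlevelSet F c) :
    c * #S ≤ ∑ v ∈ S, F v := by
  rw [mul_comm, ← nsmul_eq_mul]
  exact card_nsmul_le_sum _ _ _ fun v hv => mem_superlevelSet.1 (hS hv)

theorem mul_card_superlevelSet_le (hF : ∀ v, 0 ≤ F v) (hsum : ∑ v, F v ≤ N) (c : ℝ) :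
    c * #(superlevelSet F c) ≤ N :=
  (mul_card_le_sum_of_subset_superlevelSet Subset.rfl).trans
    ((sum_le_sum_of_subset_of_nonneg (subset_univ _) fun v _ _ => hF v).trans hsum)

theorem sum_le_card_filter_superlevelSet_add {ι : Type*} (hone : ∀ v, F v ≤ 1) (hc : 0 ≤ c)
    (S : Finset ι) (x : ι → A) [DecidablePred fun i => x i ∈ superlevelSet F c] :
    ∑ i ∈ S, F (x i) ≤ #{i ∈ S | x i ∈ superlevelSet F c} + c * #S := by
  have hcard : c * (#S : ℝ) = ∑ _i ∈ S, c := by rw [sum_const, nsmul_eq_mul, mul_comm]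
  rw [hcard, card_filter, Nat.cast_sum, ← sum_add_distrib]
  refine sum_le_sum fun i _ => ?_
  split_ifs with hi
  · push_cast
    linarith [hone (x i)]
  · rw [mem_superlevelSet, not_le] at hi
    push_cast
    linarith

theorem half_mul_le_card_superlevelSet (hF : ∀ v, 0 ≤ F v) (hone : ∀ v, F v ≤ 1)
    (hsum : ∑ v, F v ≤ N) {ε : ℝ} (hε : 0 ≤ ε) (hsq : ε * N ≤ ∑ v, F v ^ 2) :
    ε / 2 * N ≤ #(superlevelSet F (ε / 2)) := by
  classical
  have hpoint (v : A) : F v ^ 2 ≤ (if v ∈ superlevelSet F (ε / 2) then 1 else 0) + ε / 2 * F v := by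
    have := hF v
    have := hone v
    split_ifs with hv
    · nlinarith
    · rw [mem_superlevelSet, not_le] at hv
      nlinarith
  have htotal := sum_le_sum fun v (_ : v ∈ univ) => hpoint v
  rw [sum_add_distrib, ← mul_sum, sum_boole, filter_mem_eq_inter, univ_inter] at htotal
  nlinarith

end SuperlevelSet

section Subgroup

open scoped Pointwise

variable {A : Type*} [AddCommGroup A] {F : A → ℝ}

theorem IsPosDef.many_differences [Fintype A] (hF : IsPosDef F) (hone : ∀ v, F v ≤ 1)
    (hpos : ∀ v, 0 ≤ F v) {c : ℝ} (hc : 0 ≤ c)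
    [DecidablePred fun v => v ∈ superlevelSet F (c ^ 2 / 2)] :
    c ^ 2 / 2 * (#(superlevelSet F c) : ℝ) ^ 2 ≤ ∑ u ∈ superlevelSet F c,
      (#{a ∈ superlevelSet F c | a - u ∈ superlevelSet F (c ^ 2 / 2)} : ℝ) := by
  set S := superlevelSet F c
  have hsum : (∑ v ∈ S, F v) ^ 2 ≤ ∑ u ∈ S, ∑ v ∈ S, F (v - u) := by
    have h := hF.sq_sum_le (Subtype.val : S → A)
    have hcoe (u : A) : ∑ v : S, F (v - u) = ∑ v ∈ S, F (v - u) := sum_coe_sort S fun v => F (v - u)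
    rw [sum_comm, sum_coe_sort S F, sum_coe_sort S fun u => ∑ v : S, F (v - u)] at h
    simp only [hcoe] at h
    exact h.trans (mul_le_of_le_one_left
      (sum_nonneg fun _ _ => sum_nonneg fun _ _ => hpos _) (hone 0))
  have hlow : (c * #S) ^ 2 ≤ (∑ v ∈ S, F v) ^ 2 := by
    gcongr
    exact mul_card_le_sum_of_subset_superlevelSet Subset.rfl
  have hup := sum_le_sum fun u (_ : u ∈ S) =>
    sum_le_card_filter_superlevelSet_add hone (by positivity : 0 ≤ c ^ 2 / 2) S (· - u)
  rw [sum_add_distrib, sum_const, nsmul_eq_mul] at hup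
  nlinarith

open scoped Classical in
theorem IsPosDef.sum_le_sum_addSubgroup [Fintype A] (hF : IsPosDef F) (hpos : ∀ v, 0 ≤ F v)
    (H : AddSubgroup A) {S : Finset A} (hS : ∀ a ∈ S, ∀ b ∈ S, a - b ∈ H) :
    ∑ a ∈ S, F a ≤ ∑ h : H, F h := by
  rcases S.eq_empty_or_nonempty with rfl | ⟨b, hb⟩
  · exact sum_nonneg fun _ _ => hpos _
  let ι : S → H := fun a => ⟨a - b, hS a a.2 b hb⟩
  have hι : Function.Injective ι := fun a a' h =>
    Subtype.ext (sub_left_injective (congrArg Subtype.val h))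
  calc ∑ a ∈ S, F a = ∑ a : S, F (b + ι a) := by
        rw [← sum_coe_sort]
        simp [ι]
    _ = ∑ h ∈ univ.map ⟨ι, hι⟩, F (b + h) := by rw [sum_map]; rfl
    _ ≤ ∑ h : H, F (b + H.subtype h) :=
        sum_le_sum_of_subset_of_nonneg (subset_univ _) fun _ _ _ => hpos _
    _ ≤ ∑ h : H, F h := hF.sum_coset_le H.subtype b

theorem IsPosDef.exists_subset_small_doubling [Fintype A] [DecidableEq A] (hF : IsPosDef F)
    (hpos : ∀ v, 0 ≤ F v) (hone : ∀ v, F v ≤ 1) {N : ℝ} (hN : 0 < N) (hsum : ∑ v, F v ≤ N) {ε : ℝ}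
    (hε : 0 < ε) (hsq : ε * N ≤ ∑ v, F v ^ 2) :
    ∃ S ⊆ superlevelSet F (ε / 2), ε ^ 3 / 64 * N ≤ #S ∧
      (#(S - S) : ℝ) ≤ 2 ^ 46 / ε ^ 24 * #S := by
  classical
  have hlarge := half_mul_le_card_superlevelSet hpos hone hsum hε.le hsq
  have hdiff : (#(superlevelSet F (ε ^ 2 / 8)) : ℝ) ≤ 16 / ε ^ 3 * #(superlevelSet F (ε / 2)) := by
    refine le_of_mul_le_mul_left ?_ (by positivity : 0 < ε ^ 2 / 8)
    calc ε ^ 2 / 8 * (#(superlevelSet F (ε ^ 2 / 8)) : ℝ) ≤ N :=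
          mul_card_superlevelSet_le hpos hsum _
      _ = 2 / ε * (ε / 2 * N) := by field_simp
      _ ≤ 2 / ε * #(superlevelSet F (ε / 2)) := by gcongr
      _ = _ := by field_simp; ring
  have hnonempty : (superlevelSet F (ε / 2)).Nonempty :=
    card_pos.1 (Nat.cast_pos.1 (lt_of_lt_of_le (by positivity) hlarge))
  have hmany := hF.many_differences hone hpos (half_pos hε).le
  rw [show (ε / 2) ^ 2 / 2 = ε ^ 2 / 8 by ring] at hmany
  obtain ⟨S, hS, hcard, hdoubling⟩ := balog_szemeredi_gowers hnonempty
    (fun x hx => by rwa [mem_superlevelSet, hF.map_neg, ← mem_superlevelSet])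
    (by positivity) hmany hdiff
  refine ⟨S, hS, ?_, hdoubling.trans (le_of_eq ?_)⟩
  · calc ε ^ 3 / 64 * N = ε ^ 2 / 8 / 4 * (ε / 2 * N) := by ring
      _ ≤ ε ^ 2 / 8 / 4 * #(superlevelSet F (ε / 2)) := by gcongr
      _ ≤ #S := hcard
  · congr 1
    field_simp
    norm_num

open scoped Classical in
theorem IsPosDef.exists_addSubgroup [Fintype A] (R : Type*) [Ring R] [Finite R] [Module R A]
    (hF : IsPosDef F) (hpos : ∀ v, 0 ≤ F v) (hone : ∀ v, F v ≤ 1) {N : ℝ} (hN : 0 < N)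
    (hsum : ∑ v, F v ≤ N) {ε : ℝ} (hε : 0 < ε) (hsq : ε * N ≤ ∑ v, F v ^ 2) {K : ℕ}
    (hK : 2 ^ 46 / ε ^ 24 ≤ (K : ℝ)) :
    ∃ H : AddSubgroup A, (Nat.card H : ℝ) ≤ Nat.card R ^ K ^ 5 * K * (2 / ε) * N ∧
      ε ^ 4 / 128 * N ≤ ∑ h : H, F h := by
  obtain ⟨S, hS, hcard, hdoubling⟩ :=
    hF.exists_subset_small_doubling hpos hone hN hsum hε hsq
  have hnonempty : S.Nonempty :=
    card_pos.1 (Nat.cast_pos.1 (lt_of_lt_of_le (by positivity) hcard))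
  have hSK : (#(S - S) : ℝ) ≤ K * #S := hdoubling.trans (by gcongr)
  obtain ⟨H, hSH, hH⟩ := exists_addSubgroup_of_card_sub_le R hnonempty (by exact_mod_cast hSK)
  have hSsum : ε / 2 * #S ≤ ∑ v ∈ S, F v := mul_card_le_sum_of_subset_superlevelSet hS
  refine ⟨H, ?_, ?_⟩
  · have hSN : (#S : ℝ) ≤ 2 / ε * N := by
      refine le_of_mul_le_mul_left ?_ (half_pos hε)
      calc ε / 2 * (#S : ℝ) ≤ N := hSsum.trans
            ((sum_le_sum_of_subset_of_nonneg (subset_univ _) fun v _ _ => hpos v).trans hsum)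
        _ = ε / 2 * (2 / ε * N) := by field_simp
    calc (Nat.card H : ℝ) ≤ Nat.card R ^ K ^ 5 * (K * #S) := by exact_mod_cast hH
      _ ≤ Nat.card R ^ K ^ 5 * (K * (2 / ε * N)) := by gcongr
      _ = _ := by ring
  · calc ε ^ 4 / 128 * N = ε / 2 * (ε ^ 3 / 64 * N) := by ring
      _ ≤ ε / 2 * #S := by gcongr
      _ ≤ ∑ h : H, F h := hSsum.trans (hF.sum_le_sum_addSubgroup hpos H hSH)

end Subgroup

/-! ### From subgroups to graphs of linear maps -/

section Graph

theorem exists_linearMap_mem_of_submodule_prod {K V W : Type*} [DivisionRing K] [AddCommGroup V]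
    [Module K V] [AddCommGroup W] [Module K W] (H : Submodule K (V × W)) :
    ∃ T : V →ₗ[K] W, ∀ v w, (v, w) ∈ H → (v, T v) ∈ H := by
  let π : H →ₗ[K] V := LinearMap.fst K V W ∘ₗ H.subtype
  obtain ⟨s, hs⟩ := π.rangeRestrict.exists_rightInverse_of_surjective π.range_rangeRestrict
  obtain ⟨s', hs'⟩ := LinearMap.exists_extend s
  refine ⟨LinearMap.snd K V W ∘ₗ H.subtype ∘ₗ s', fun v w hvw => ?_⟩
  let v' : LinearMap.range π := ⟨v, ⟨(v, w), hvw⟩, rfl⟩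
  have hsection : π (s' v) = v := by
    rw [show s' v = s v' from DFunLike.congr_fun hs' v']
    exact congrArg Subtype.val (DFunLike.congr_fun hs v')
  have hmem := (s' v).2
  rwa [← Prod.mk.eta (p := (s' v : V × W)), show (s' v : V × W).1 = v from hsection] at hmem

variable {A B : Type*} [AddCommGroup A] [AddCommGroup B] [Fintype A] [Fintype B]

open scoped Classical in
theorem sum_addSubgroup_prod_eq {M : Type*} [AddCommMonoid M] {H : AddSubgroup (A × B)} {T : A →+ B}
    (hT : ∀ a b, (a, b) ∈ H → (a, T a) ∈ H) (F : A × B → M) :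
    ∑ v : H, F v = ∑ k with ((0 : A), k) ∈ H, ∑ a with (a, T a) ∈ H, F (a, k + T a) := by
  rw [← sum_subtype {v | v ∈ H} (fun v => by simp) F, ← sum_product']
  refine sum_nbij' (fun v => (v.2 - T v.1, v.1)) (fun q => (q.2, q.1 + T q.2)) ?_ ?_ ?_ ?_ ?_
  · rintro ⟨a, b⟩ hv
    simp only [mem_filter, mem_univ, true_and, mem_product] at hv ⊢
    exact ⟨by simpa using H.sub_mem hv (hT a b hv), hT a b hv⟩
  · rintro ⟨k, a⟩ hq
    simp only [mem_filter, mem_univ, true_and, mem_product] at hq ⊢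
    simpa using H.add_mem hq.1 hq.2
  all_goals simp

open scoped Classical in
theorem IsPosDef.exists_graph {p : ℕ} [Fact p.Prime] [Module (ZMod p) A] [Module (ZMod p) B]
    {F : A × B → ℝ} (hF : IsPosDef F) (hpos : ∀ v, 0 ≤ F v) (hfiber : ∀ a, ∑ b, F (a, b) ≤ 1)
    (H : AddSubgroup (A × B)) {η C : ℝ} (hη : 0 < η) (hC : 0 < C)
    (hcard : (Nat.card H : ℝ) ≤ C * Fintype.card A) (hsum : η * Fintype.card A ≤ ∑ v : H, F v) :
    ∃ T : A →+ B, η ^ 2 / C ≤ 𝔼 a, F (a, T a) := by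
  obtain ⟨T, hT⟩ := exists_linearMap_mem_of_submodule_prod (AddSubgroup.toZModSubmodule p H)
  let S := univ.filter fun a => (a, T a) ∈ H
  let K := univ.filter fun k => ((0 : A), k) ∈ H
  have hN : (0 : ℝ) < Fintype.card A := Nat.cast_pos.2 Fintype.card_pos
  have hdecomp {M : Type} [AddCommMonoid M] (F : A × B → M) :
      ∑ v : H, F v = ∑ k ∈ K, ∑ a ∈ S, F (a, k + T a) :=
    sum_addSubgroup_prod_eq (T := T.toAddMonoidHom) hT F
  have hKS : (#K : ℝ) * #S ≤ C * Fintype.card A := by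
    have hprod := hdecomp fun _ => 1
    simp only [sum_const, card_univ, smul_eq_mul, mul_one] at hprod
    rw [Nat.card_eq_fintype_card, hprod] at hcard
    exact_mod_cast hcard
  have hS : η * Fintype.card A ≤ #S := by
    refine hsum.trans ?_
    rw [hdecomp, sum_comm]
    calc ∑ a ∈ S, ∑ k ∈ K, F (a, k + T a) ≤ ∑ _a ∈ S, (1 : ℝ) := by
          refine sum_le_sum fun a _ => le_trans ?_ (hfiber a)
          rw [← Equiv.sum_comp (Equiv.addRight (T a)) fun b => F (a, b)]
          exact sum_le_sum_of_subset_of_nonneg (subset_univ _) fun _ _ _ => hpos _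
      _ = #S := by simp
  have hK : ∑ v : H, F v ≤ #K * ∑ a, F (a, T a) := by
    rw [hdecomp, ← nsmul_eq_mul]
    refine sum_le_card_nsmul _ _ _ fun k _ => ?_
    refine (sum_le_sum_of_subset_of_nonneg (subset_univ _) fun _ _ _ => hpos _).trans ?_
    simpa using hF.sum_coset_le ((AddMonoidHom.id A).prod T.toAddMonoidHom) (0, k)
  have hKC : η * #K ≤ C := by
    refine le_of_mul_le_mul_right (le_trans ?_ hKS) hN
    nlinarith [Nat.cast_nonneg (α := ℝ) #K]
  refine ⟨T.toAddMonoidHom, ?_⟩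
  rw [Fintype.expect_eq_sum_div_card, div_le_div_iff₀ hC hN]
  have hnonneg : 0 ≤ ∑ a, F (a, T a) := sum_nonneg fun _ _ => hpos _
  calc η ^ 2 * (Fintype.card A : ℝ) = η * (η * Fintype.card A) := by ring
    _ ≤ η * (#K * ∑ a, F (a, T a)) := mul_le_mul_of_nonneg_left (hsum.trans hK) hη.le
    _ = η * #K * ∑ a, F (a, T a) := by ring
    _ ≤ C * ∑ a, F (a, T a) := by gcongr
    _ = _ := mul_comm _ _

end Graph

/-! ### The symmetry argument -/

section Symmetry

variable {G : Type*} [AddCommGroup G]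

/-- The transpose of a bicharacter `T`, viewed as a homomorphism from `G` to its dual. -/
def transpose (T : G →+ AddChar G ℂ) : G →+ AddChar G ℂ where
  toFun a :=
    { toFun := fun b => T b a
      map_zero_eq_one' := by simp
      map_add_eq_mul' := fun b c => by simp }
  map_zero' := by ext; simp
  map_add' a b := by ext c; exact AddChar.map_add_eq_mul (T c) a b

theorem transpose_apply (T : G →+ AddChar G ℂ) (a b : G) : transpose T a b = T b a := rfl

/-- The bicharacter `T` is symmetric. -/
def IsSymmBichar (T : G →+ AddChar G ℂ) : Prop := ∀ a b, T a b = T b a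

theorem isSymmBichar_nsmul_add_transpose (m : ℕ) (T : G →+ AddChar G ℂ) :
    IsSymmBichar (m • (T + transpose T)) := fun a b => by
  simp only [AddMonoidHom.nsmul_apply, AddMonoidHom.add_apply, AddChar.nsmul_apply,
    AddChar.add_apply, transpose_apply, mul_comm]

variable [Fintype G]

theorem natCard_ker_div_card_eq_expect (L : G →+ AddChar G ℂ) :
    (Nat.card L.ker : ℝ) / Fintype.card G = 𝔼 k, if L k = 0 then (1 : ℝ) else 0 := by
  classical
  rw [Fintype.expect_eq_sum_div_card, sum_boole, ← Fintype.card_subtype, Nat.card_eq_fintype_card]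
  simp only [← AddMonoidHom.mem_ker]

open scoped Classical in
theorem expect_norm_sq_expect_mul_bichar (P : G → ℂ) (L : G →+ AddChar G ℂ) :
    ((𝔼 b, ‖𝔼 a, P a * L a b‖ ^ 2 : ℝ) : ℂ) =
      𝔼 k, (𝔼 a, mulDeriv k P a) * if L k = 0 then 1 else 0 := by
  have hderiv (b : G) : (‖𝔼 a, P a * L a b‖ ^ 2 : ℂ) =
      𝔼 k, 𝔼 a, mulDeriv k P a * L k b := by
    rw [norm_expect_sq_eq]
    refine expect_congr rfl fun k _ => expect_congr rfl fun a _ => ?_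
    have hunit : L a b * conj (L a b) = 1 := by simp [Complex.mul_conj']
    simp only [mulDeriv, map_mul, map_add, AddChar.add_apply]
    linear_combination (P (a + k) * conj (P a) * L k b) * hunit
  push_cast
  simp only [hderiv]
  rw [expect_comm]
  refine expect_congr rfl fun k _ => ?_
  rw [expect_comm, expect_mul]
  refine expect_congr rfl fun a _ => ?_
  rw [← mul_expect, AddChar.expect_eq_ite]

theorem norm_expect_bilinear_sq_le {P Q : G → ℂ} (hP : ∀ a, ‖P a‖ ≤ 1) (hQ : ∀ b, ‖Q b‖ ≤ 1)
    (L : G →+ AddChar G ℂ) :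
    ‖𝔼 a, 𝔼 b, P a * Q b * L a b‖ ^ 2 ≤ (Nat.card L.ker : ℝ) / Fintype.card G := by
  classical
  calc ‖𝔼 a, 𝔼 b, P a * Q b * L a b‖ ^ 2 = ‖𝔼 b, Q b * 𝔼 a, P a * L a b‖ ^ 2 := by
        rw [expect_comm]
        simp only [mul_expect, mul_assoc, mul_left_comm (Q _)]
    _ ≤ 𝔼 b, ‖Q b * 𝔼 a, P a * L a b‖ ^ 2 := norm_expect_sq_le _
    _ ≤ 𝔼 b, ‖𝔼 a, P a * L a b‖ ^ 2 := by
        gcongr with b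
        rw [norm_mul]
        exact mul_le_of_le_one_left (norm_nonneg _) (hQ b)
    _ ≤ ‖((𝔼 b, ‖𝔼 a, P a * L a b‖ ^ 2 : ℝ) : ℂ)‖ := by
        rw [Complex.norm_real]
        exact le_abs_self _
    _ ≤ 𝔼 k, if L k = 0 then (1 : ℝ) else 0 := by
        rw [expect_norm_sq_expect_mul_bichar]
        refine (RCLike.norm_expect_le (K := ℂ)).trans (expect_le_expect fun k _ => ?_)
        split_ifs
        · rw [mul_one]
          exact (RCLike.norm_expect_le (K := ℂ)).trans
            (expect_le univ_nonempty fun a _ => norm_mulDeriv_le_one hP k a)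
        · simp
    _ = _ := (natCard_ker_div_card_eq_expect L).symm

theorem expect_ambiguity_graph_eq (f : G → ℂ) (T : G →+ AddChar G ℂ) :
    ((𝔼 h, ambiguity f (h, T h) : ℝ) : ℂ) = 𝔼 s, 𝔼 a, 𝔼 b,
      (conj (f a * f (s - a) * T s a) * T a a) * (f b * f (s - b) * T s b * conj (T b b)) *
        (transpose T - T) a b := by
  have hexpand (h : G) : (ambiguity f (h, T h) : ℂ) =
      𝔼 k, 𝔼 b, mulDeriv k (mulDeriv h f) b * conj (T h k) := by
    rw [ambiguity, Complex.ofReal_pow, fourierCoeff, norm_expect_sq_eq]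
    refine expect_congr rfl fun k _ => expect_congr rfl fun b _ => ?_
    have hunit : T h b * conj (T h b) = 1 := by simp [Complex.mul_conj']
    simp only [mulDeriv, map_mul, AddChar.map_add_eq_mul, Complex.conj_conj]
    linear_combination (conj (T h k) * f (b + k + h) * conj (f (b + k)) *
      conj (f (b + h)) * f b) * hunit
  have hsubst (Φ : G → G → G → ℂ) :
      𝔼 h, 𝔼 k, 𝔼 b, Φ h k b = 𝔼 s, 𝔼 a, 𝔼 b, Φ (s - a - b) (a - b) b := by
    let e : G × G × G ≃ G × G × G :=
      { toFun := fun q => (q.1 - q.2.1 - q.2.2, q.2.1 - q.2.2, q.2.2)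
        invFun := fun q => (q.1 + (q.2.1 + q.2.2) + q.2.2, q.2.1 + q.2.2, q.2.2)
        left_inv := fun q => by ext <;> dsimp only <;> abel
        right_inv := fun q => by ext <;> dsimp only <;> abel }
    simp only [← expect_product', univ_product_univ]
    exact (Fintype.expect_equiv e _ _ fun _ => rfl).symm
  push_cast
  simp only [hexpand]
  rw [hsubst]
  refine expect_congr rfl fun s _ => expect_congr rfl fun a _ => expect_congr rfl fun b _ => ?_
  have hab : b + (a - b) = a := by abel
  have hsa : b + (s - a - b) = s - a := by abel
  have hsb : a + (s - a - b) = s - b := by abel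
  have hdiff : (transpose T - T) a b = T b a * conj (T a b) := by
    rw [AddMonoidHom.sub_apply, AddChar.sub_apply, AddChar.map_neg_eq_conj, transpose_apply]
  simp only [mulDeriv, hab, hsa, hsb, hdiff, map_sub, map_mul, Complex.conj_conj]
  simp only [sub_eq_add_neg, AddChar.map_add_eq_mul, AddChar.add_apply, AddChar.neg_apply,
    AddChar.map_neg_eq_conj, map_mul, Complex.conj_conj]
  ring

theorem sq_expect_ambiguity_graph_le {f : G → ℂ} (hf : ∀ x, ‖f x‖ ≤ 1) (T : G →+ AddChar G ℂ) :
    (𝔼 h, ambiguity f (h, T h)) ^ 2 ≤ (Nat.card (transpose T - T).ker : ℝ) / Fintype.card G := by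
  have hff (x y : G) : ‖f x * f y‖ ≤ 1 := by
    rw [norm_mul]
    exact mul_le_one₀ (hf x) (norm_nonneg _) (hf y)
  calc (𝔼 h, ambiguity f (h, T h)) ^ 2 = ‖((𝔼 h, ambiguity f (h, T h) : ℝ) : ℂ)‖ ^ 2 := by
        rw [Complex.norm_real, Real.norm_eq_abs, sq_abs]
    _ ≤ 𝔼 s, _ := by
        rw [expect_ambiguity_graph_eq]
        exact norm_expect_sq_le _
    _ ≤ _ := expect_le univ_nonempty fun s _ => norm_expect_bilinear_sq_le
        (fun a => by simpa using hff a (s - a)) (fun b => by simpa using hff b (s - b)) _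

end Symmetry

section Inverse

variable {G : Type*} [AddCommGroup G] [Fintype G]

theorem IsPosDef.card_mul_sum_le {A : Type*} [AddCommGroup A] {F : A → ℝ} (hF : IsPosDef F)
    (φ : G →+ A) (W : AddSubgroup G) [Fintype W] :
    Fintype.card W * ∑ g, F (φ g) ≤ Fintype.card G * ∑ w : W, F (φ w) := by
  calc Fintype.card W * ∑ g, F (φ g) = ∑ w : W, ∑ g, F (φ g + φ w) := by
        rw [← nsmul_eq_mul, ← card_univ, ← sum_const]
        refine sum_congr rfl fun w _ => ?_
        rw [← Equiv.sum_comp (Equiv.addRight (w : G))]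
        simp only [Equiv.coe_addRight, map_add]
    _ = ∑ g, ∑ w : W, F (φ g + φ w) := sum_comm
    _ ≤ ∑ _g : G, ∑ w : W, F (φ w) :=
        sum_le_sum fun g _ => hF.sum_coset_le (φ.comp W.subtype) (φ g)
    _ = _ := by rw [sum_const, nsmul_eq_mul, card_univ]

theorem exists_isSymmBichar_of_le_expect_ambiguity {f : G → ℂ} (hf : ∀ x, ‖f x‖ ≤ 1) {m : ℕ}
    (hm : ∀ x : G, (4 * m) • x = x) (T : G →+ AddChar G ℂ) {η : ℝ} (hη : 0 ≤ η)
    (hT : η ≤ 𝔼 h, ambiguity f (h, T h)) :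
    ∃ B : G →+ AddChar G ℂ, IsSymmBichar B ∧ η ^ 3 ≤ 𝔼 h, ambiguity f (h, 2 • B h) := by
  classical
  let W := (transpose T - T).ker
  let B := m • (T + transpose T)
  have hN : (0 : ℝ) < Fintype.card G := Nat.cast_pos.2 Fintype.card_pos
  have hBT (w : W) : 2 • B w = T w := by
    have hw : transpose T w = T w := sub_eq_zero.1 w.2
    calc 2 • B w = (4 * m) • T w := by
          simp only [B, AddMonoidHom.nsmul_apply, AddMonoidHom.add_apply, hw]
          module
      _ = T w := by rw [← map_nsmul, hm]
  have hW : η ^ 2 ≤ Nat.card W / Fintype.card G :=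
    (pow_le_pow_left₀ hη hT 2).trans (sq_expect_ambiguity_graph_le hf T)
  rw [Nat.card_eq_fintype_card] at hW
  have haverage := (isPosDef_ambiguity f).card_mul_sum_le ((AddMonoidHom.id G).prod T) W
  have hextend : ∑ w : W, ambiguity f (w, T w) ≤ ∑ h, ambiguity f (h, 2 • B h) := by
    simp only [← hBT]
    rw [← sum_subtype (univ.filter (· ∈ W)) (by simp) fun h => ambiguity f (h, 2 • B h)]
    exact sum_le_sum_of_subset_of_nonneg (subset_univ _) fun _ _ _ => ambiguity_nonneg f _
  refine ⟨B, isSymmBichar_nsmul_add_transpose m T, ?_⟩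
  rw [Fintype.expect_eq_sum_div_card] at hT ⊢
  calc η ^ 3 = η ^ 2 * η := by ring
    _ ≤ (Fintype.card W / Fintype.card G) * ((∑ h, ambiguity f (h, T h)) / Fintype.card G) :=
        mul_le_mul hW hT hη (by positivity)
    _ = (Fintype.card W * ∑ h, ambiguity f (h, T h)) / Fintype.card G / Fintype.card G := by ring
    _ ≤ (Fintype.card G * ∑ w : W, ambiguity f (w, T w)) / Fintype.card G / Fintype.card G :=
        div_le_div_of_nonneg_right (div_le_div_of_nonneg_right haverage hN.le) hN.le
    _ ≤ _ := by
        rw [mul_div_cancel_left₀ _ hN.ne']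
        gcongr

theorem norm_sq_expect_mulDeriv_mul_conj (f : G → ℂ) {B : G →+ AddChar G ℂ} (hB : IsSymmBichar B)
    (h : G) :
    ‖𝔼 x, mulDeriv h (fun x => f x * conj (B x x)) x‖ ^ 2 = ambiguity f (h, 2 • B h) := by
  have hderiv (x : G) : mulDeriv h (fun x => f x * conj (B x x)) x =
      conj (B h h) * (conj ((2 • B h) x) * mulDeriv h f x) := by
    have hunit : B x x * conj (B x x) = 1 := by simp [Complex.mul_conj']
    simp only [mulDeriv, map_add, AddChar.add_apply, AddChar.map_add_eq_mul, AddChar.nsmul_apply,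
      map_mul, map_pow, Complex.conj_conj, hB x h]
    linear_combination (f (x + h) * conj (f x) * conj (B h h) * conj (B h x) ^ 2) * hunit
  simp only [hderiv, ← mul_expect, ambiguity, fourierCoeff, norm_mul, RCLike.norm_conj,
    AddChar.norm_apply, one_mul]

theorem exists_le_norm_sq_fourierCoeff {g : G → ℂ} (hg : ∀ x, ‖g x‖ ≤ 1) :
    ∃ χ, 𝔼 h, ‖𝔼 x, mulDeriv h g x‖ ^ 2 ≤ ‖fourierCoeff g χ‖ ^ 2 := by
  obtain ⟨χ, hχ⟩ := Finite.exists_max fun χ => ‖fourierCoeff g χ‖ ^ 2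
  refine ⟨χ, ?_⟩
  calc 𝔼 h, ‖𝔼 x, mulDeriv h g x‖ ^ 2 = ∑ ψ, ‖fourierCoeff g ψ‖ ^ 4 :=
        (sum_norm_fourierCoeff_pow_four g).symm
    _ ≤ ∑ ψ, ‖fourierCoeff g χ‖ ^ 2 * ‖fourierCoeff g ψ‖ ^ 2 := by
        refine sum_le_sum fun ψ _ => ?_
        rw [show 4 = 2 + 2 from rfl, pow_add]
        exact mul_le_mul_of_nonneg_right (hχ ψ) (sq_nonneg _)
    _ = ‖fourierCoeff g χ‖ ^ 2 * 𝔼 x, ‖g x‖ ^ 2 := by rw [← mul_sum, sum_norm_sq_fourierCoeff]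
    _ ≤ _ := mul_le_of_le_one_right (sq_nonneg _) <|
        expect_le univ_nonempty fun x _ => pow_le_one₀ (norm_nonneg _) (hg x)

theorem exists_le_norm_sq_expect_mul_conj {f : G → ℂ} (hf : ∀ x, ‖f x‖ ≤ 1)
    {B : G →+ AddChar G ℂ} (hB : IsSymmBichar B) :
    ∃ χ : AddChar G ℂ,
      𝔼 h, ambiguity f (h, 2 • B h) ≤ ‖𝔼 x, f x * conj (B x x * χ x)‖ ^ 2 := by
  simp only [← norm_sq_expect_mulDeriv_mul_conj f hB]
  obtain ⟨χ, hχ⟩ := exists_le_norm_sq_fourierCoeff (g := fun x => f x * conj (B x x))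
    fun x => by simpa using hf x
  refine ⟨χ, hχ.trans_eq ?_⟩
  simp only [fourierCoeff, map_mul, mul_comm, mul_left_comm]

theorem exists_addMonoidHom_le_expect_ambiguity (p : ℕ) [Fact p.Prime] {ε : ℝ} (hε : 0 < ε) :
    ∃ η : ℝ, 0 < η ∧ ∀ (G : Type*) [AddCommGroup G] [Fintype G] [Module (ZMod p) G] (f : G → ℂ),
      (∀ x, ‖f x‖ ≤ 1) → ε ≤ u3Pow f →
        ∃ T : G →+ AddChar G ℂ, η ≤ 𝔼 h, ambiguity f (h, T h) := by
  classical
  obtain ⟨K, hK⟩ := exists_nat_ge (2 ^ 46 / ε ^ 24)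
  have hKpos : (0 : ℝ) < K := lt_of_lt_of_le (by positivity) hK
  have hp : (0 : ℝ) < p := Nat.cast_pos.2 (Fact.out : p.Prime).pos
  let C : ℝ := p ^ K ^ 5 * K * (2 / ε)
  have hC : 0 < C := by positivity
  refine ⟨(ε ^ 4 / 128) ^ 2 / C, by positivity, fun G _ _ _ f hf hu3 => ?_⟩
  let _ : Module (ZMod p) (AddChar G ℂ) := AddCommGroup.zmodModule fun χ => by
    ext x
    rw [AddChar.nsmul_apply, ← AddChar.map_nsmul_eq_pow, ← Nat.cast_smul_eq_nsmul (ZMod p)]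
    simp
  have hN : (0 : ℝ) < Fintype.card G := Nat.cast_pos.2 Fintype.card_pos
  have hsq : ε * Fintype.card G ≤ ∑ v, ambiguity f v ^ 2 := by
    rw [Fintype.sum_prod_type]
    rwa [u3Pow_eq_expect_sum_ambiguity_sq, Fintype.expect_eq_sum_div_card,
      le_div_iff₀ hN] at hu3
  obtain ⟨H, hcard, hsum⟩ := (isPosDef_ambiguity f).exists_addSubgroup (ZMod p)
    (ambiguity_nonneg f) (ambiguity_le_one hf) hN (sum_ambiguity_le_card hf) hε hsq hK
  rw [Nat.card_zmod] at hcard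
  exact (isPosDef_ambiguity f).exists_graph (p := p) (ambiguity_nonneg f)
    (sum_ambiguity_fiber_le_one hf) H (by positivity) hC hcard hsum

theorem exists_isSymmBichar_correlation {p : ℕ} [Fact p.Prime] (hp : p ≠ 2) {ε : ℝ}
    (hε : 0 < ε) :
    ∃ η : ℝ, 0 < η ∧ ∀ (G : Type*) [AddCommGroup G] [Fintype G] [Module (ZMod p) G] (f : G → ℂ),
      (∀ x, ‖f x‖ ≤ 1) → ε ≤ u3Pow f →
        ∃ B : G →+ AddChar G ℂ, IsSymmBichar B ∧
          ∃ χ : AddChar G ℂ, η ≤ ‖𝔼 x, f x * conj (B x x * χ x)‖ := by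
  obtain ⟨η, hη, hgraph⟩ := exists_addMonoidHom_le_expect_ambiguity p hε
  refine ⟨√(η ^ 3), by positivity, fun G _ _ _ f hf hu3 => ?_⟩
  obtain ⟨T, hT⟩ := hgraph G f hf hu3
  have hfour (x : G) : (4 * (4⁻¹ : ZMod p).val) • x = x := by
    have hne : (4 : ZMod p) ≠ 0 := by
      rw [show (4 : ZMod p) = 2 * 2 by norm_num]
      exact mul_self_ne_zero.2 (Ring.two_ne_zero (by rwa [ZMod.ringChar_zmod_n]))
    rw [← Nat.cast_smul_eq_nsmul (ZMod p)]
    simp [hne]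
  obtain ⟨B, hB, hBη⟩ := exists_isSymmBichar_of_le_expect_ambiguity hf hfour T hη.le hT
  obtain ⟨χ, hχ⟩ := exists_le_norm_sq_expect_mul_conj hf hB
  exact ⟨B, hB, χ, Real.sqrt_le_iff.2 ⟨norm_nonneg _, hBη.trans hχ⟩⟩

end Inverse

/-! ### The inverse theorem in coordinates -/

section Coordinates

variable {m : ℕ} [NeZero m] {ι : Type*} [Fintype ι]

/-- The character `x ↦ e(r ⬝ᵥ x)` of `(ℤ/m)^ι`, where `e` is the standard character of `ℤ/m`. -/
def dotProductChar : (ι → ZMod m) →+ AddChar (ι → ZMod m) ℂ where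
  toFun r := ZMod.stdAddChar.compAddMonoidHom (AddMonoidHom.mk' (r ⬝ᵥ ·) (dotProduct_add r))
  map_zero' := by ext; simp
  map_add' r s := by ext x; simp [add_dotProduct, AddChar.map_add_eq_mul]

theorem dotProductChar_apply (r x : ι → ZMod m) :
    dotProductChar r x = ZMod.stdAddChar (r ⬝ᵥ x) := rfl

theorem bijective_dotProductChar :
    Function.Bijective (dotProductChar : (ι → ZMod m) →+ AddChar (ι → ZMod m) ℂ) := by
  classical
  rw [Fintype.bijective_iff_injective_and_card]
  refine ⟨fun r s hrs => ?_, (AddChar.card_eq (α := ι → ZMod m)).symm⟩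
  refine dotProduct_eq _ _ fun x => ZMod.injective_stdAddChar ?_
  rw [← dotProductChar_apply, hrs, dotProductChar_apply]

theorem IsSymmBichar.exists_isSymm_matrix {B : (ι → ZMod m) →+ AddChar (ι → ZMod m) ℂ}
    (hB : IsSymmBichar B) :
    ∃ M : Matrix ι ι (ZMod m), M.IsSymm ∧ ∀ a b, B a b = ZMod.stdAddChar (b ⬝ᵥ M.mulVec a) := by
  classical
  let e := AddEquiv.ofBijective dotProductChar (bijective_dotProductChar (m := m) (ι := ι))
  let L := (e.symm.toAddMonoidHom.comp B).toZModLinearMap m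
  let M := LinearMap.toMatrix' L
  have hM (a b : ι → ZMod m) : B a b = ZMod.stdAddChar (b ⬝ᵥ M.mulVec a) := by
    rw [LinearMap.toMatrix'_mulVec, dotProduct_comm, ← dotProductChar_apply]
    exact congrArg (· b) (e.apply_symm_apply (B a)).symm
  refine ⟨M, Matrix.IsSymm.ext fun i j => ?_, hM⟩
  have hij := hB (Pi.single i 1) (Pi.single j 1)
  rw [hM, hM] at hij
  simpa using ZMod.injective_stdAddChar hij

/-- The quadratic phase `x ↦ e(xᵀ M x + rᵀ x)` on `(ℤ/m)^ι`. -/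
def quadPhase (M : Matrix ι ι (ZMod m)) (r x : ι → ZMod m) : ℂ :=
  ZMod.stdAddChar (x ⬝ᵥ M.mulVec x + r ⬝ᵥ x)

theorem norm_quadPhase (M : Matrix ι ι (ZMod m)) (r x : ι → ZMod m) : ‖quadPhase M r x‖ = 1 :=
  AddChar.norm_apply _ _

theorem IsSymmBichar.exists_eq_quadPhase {B : (ι → ZMod m) →+ AddChar (ι → ZMod m) ℂ}
    (hB : IsSymmBichar B) (χ : AddChar (ι → ZMod m) ℂ) :
    ∃ M : Matrix ι ι (ZMod m), M.IsSymm ∧ ∃ r, ∀ x, B x x * χ x = quadPhase M r x := by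
  obtain ⟨M, hM, hBM⟩ := hB.exists_isSymm_matrix
  obtain ⟨r, rfl⟩ := bijective_dotProductChar.2 χ
  exact ⟨M, hM, r, fun x => by
    rw [hBM, dotProductChar_apply, quadPhase, AddChar.map_add_eq_mul]⟩

end Coordinates

section U3Norm

theorem ofReal_u3Pow {G : Type*} [AddCommGroup G] [Fintype G] (f : G → ℂ) :
    (u3Pow f : ℂ) = 𝔼 x, 𝔼 h, 𝔼 k, 𝔼 l, mulDeriv l (mulDeriv k (mulDeriv h f)) x := by
  rw [u3Pow]
  push_cast
  simp only [norm_expect_sq_eq]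
  rw [expect_comm (t := univ) (f := fun x h => 𝔼 k, 𝔼 l, mulDeriv l (mulDeriv k (mulDeriv h f)) x)]
  refine expect_congr rfl fun h _ => ?_
  rw [expect_comm (f := fun x k => 𝔼 l, mulDeriv l (mulDeriv k (mulDeriv h f)) x)]
  exact expect_congr rfl fun k _ => expect_comm _ _ _

theorem u3Pow_const_mul {G : Type*} [AddCommGroup G] [Fintype G] (c : ℂ) (f : G → ℂ) :
    u3Pow (fun x => c * f x) = ‖c‖ ^ 8 * u3Pow f := by
  simp only [u3Pow, mul_expect]
  refine expect_congr rfl fun h _ => expect_congr rfl fun k _ => ?_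
  have hderiv (x : G) : mulDeriv k (mulDeriv h fun x => c * f x) x =
      (c * conj c) ^ 2 * mulDeriv k (mulDeriv h f) x := by
    simp only [mulDeriv, map_mul, Complex.conj_conj]
    ring
  simp only [hderiv, ← mul_expect, norm_mul, norm_pow, RCLike.norm_conj]
  ring

theorem u3Pow_nonneg {G : Type*} [AddCommGroup G] [Fintype G] (f : G → ℂ) : 0 ≤ u3Pow f :=
  expect_nonneg fun _ _ => expect_nonneg fun _ _ => sq_nonneg _

theorem u3Norm_eq_u3Pow_rpow {n : ℕ} (f : V n → ℝ) :
    u3Norm f = u3Pow (fun x => (f x : ℂ)) ^ (1 / 8 : ℝ) := by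
  rw [u3Norm]
  congr 1
  rw [← Complex.ofReal_inj, ofReal_u3Pow]
  push_cast
  refine expect_congr rfl fun x _ => expect_congr rfl fun h _ => expect_congr rfl fun k _ =>
    expect_congr rfl fun l _ => ?_
  simp only [mulDeriv, map_mul, Complex.conj_ofReal, add_right_comm x l k,
    add_right_comm x l h, add_right_comm x k h, add_right_comm (x + k) l h]
  ring

theorem pow_eight_le_u3Pow {n : ℕ} {f : V n → ℝ} {ε : ℝ} (hε : 0 ≤ ε) (h : ε ≤ u3Norm f) :
    ε ^ 8 ≤ u3Pow fun x => (f x : ℂ) := by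
  rw [u3Norm_eq_u3Pow_rpow] at h
  calc ε ^ 8 ≤ ((u3Pow fun x => (f x : ℂ)) ^ (1 / 8 : ℝ)) ^ 8 := pow_le_pow_left₀ hε h 8
    _ = _ := by simpa using Real.rpow_inv_natCast_pow (u3Pow_nonneg _) (n := 8) (by norm_num)

theorem exists_quadPhase_correlation {ε R : ℝ} (hε : 0 < ε) (hR : 0 < R) :
    ∃ η : ℝ, 0 < η ∧ ∀ (n : ℕ) (g : V n → ℝ), (∀ x, |g x| ≤ R) → ε ≤ u3Norm g →
      ∃ M : Matrix (Fin n) (Fin n) (ZMod 5), M.IsSymm ∧ ∃ r,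
        η ≤ ‖𝔼 x, g x * quadPhase M r x‖ := by
  have : Fact (Nat.Prime 5) := ⟨by norm_num⟩
  obtain ⟨η, hη, hinverse⟩ := exists_isSymmBichar_correlation (p := 5) (by norm_num)
    (ε := (ε / R) ^ 8) (by positivity)
  refine ⟨R * η, by positivity, fun n g hg hu3 => ?_⟩
  let f (x : V n) : ℂ := (R⁻¹ : ℝ) * g x
  have hf (x : V n) : ‖f x‖ ≤ 1 := by
    rw [norm_mul, Complex.norm_real, Complex.norm_real, Real.norm_of_nonneg (inv_nonneg.2 hR.le)]
    exact inv_mul_le_one_of_le₀ (hg x) hR.le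
  have hfu3 : (ε / R) ^ 8 ≤ u3Pow f := by
    rw [u3Pow_const_mul, Complex.norm_real, Real.norm_of_nonneg (inv_nonneg.2 hR.le),
      div_eq_inv_mul, mul_pow]
    gcongr
    exact pow_eight_le_u3Pow hε.le hu3
  obtain ⟨B, hB, χ, hχ⟩ := hinverse (V n) f hf hfu3
  obtain ⟨M, hM, r, hMr⟩ := hB.exists_eq_quadPhase χ
  refine ⟨M, hM, r, ?_⟩
  have hconj : 𝔼 x, f x * conj (B x x * χ x) =
      (R⁻¹ : ℝ) * conj (𝔼 x, g x * quadPhase M r x) := by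
    simp only [conj_expect, mul_expect, hMr, f, map_mul, Complex.conj_ofReal, mul_assoc]
  rw [hconj, norm_mul, RCLike.norm_conj, Complex.norm_real,
    Real.norm_of_nonneg (inv_nonneg.2 hR.le)] at hχ
  rwa [← le_inv_mul_iff₀ hR]

end U3Norm

/-! ### Conditional expectations and energy -/

section Factor

variable {n : ℕ} {A B B' : MeasurableSpace (V n)}

theorem mem_atom_self (B : MeasurableSpace (V n)) (x : V n) : x ∈ atom B x :=
  @mem_measurableAtom_self _ B x

theorem atom_eq_of_mem {x y : V n} (h : y ∈ atom B x) : atom B y = atom B x :=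
  @measurableAtom_eq_of_mem _ B _ _ h

theorem mem_atom_comm {x y : V n} : y ∈ atom B x ↔ x ∈ atom B y :=
  ⟨fun h => atom_eq_of_mem h ▸ mem_atom_self B x, fun h => atom_eq_of_mem h ▸ mem_atom_self B y⟩

theorem Refines.atom_subset (h : Refines B' B) (x : V n) : atom B' x ⊆ atom B x := by
  obtain ⟨y, hy⟩ := h x
  rwa [atom_eq_of_mem (hy (mem_atom_self B' x))]

theorem Refines.refl (B : MeasurableSpace (V n)) : Refines B B := fun x => ⟨x, subset_rfl⟩

theorem Refines.trans (h : Refines B' B) (h' : Refines B A) : Refines B' A :=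
  fun x => ⟨x, (h.atom_subset x).trans (h'.atom_subset x)⟩

/-- `h` is constant on every atom of `B`, that is, measurable with respect to the factor `B`. -/
def ConstOnAtoms {β : Type*} (B : MeasurableSpace (V n)) (h : V n → β) : Prop :=
  ∀ x, ∀ y ∈ atom B x, h y = h x

theorem ConstOnAtoms.mono {β : Type*} {h : V n → β} (hh : ConstOnAtoms B h) (hB : Refines B' B) :
    ConstOnAtoms B' h :=
  fun x y hy => hh x y (hB.atom_subset x hy)

theorem constOnAtoms_condExpect (f : V n → ℝ) (B : MeasurableSpace (V n)) :
    ConstOnAtoms B (condExpect f B) := by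
  intro x y hy
  rw [condExpect, condExpect, atom_eq_of_mem hy]

open Classical in
theorem expect_expect_atom {M : Type*} [AddCommMonoid M] [Module ℚ≥0 M]
    (B : MeasurableSpace (V n)) (g : V n → M) :
    𝔼 x, 𝔼 y with y ∈ atom B x, g y = 𝔼 x, g x := by
  refine congrArg (_ • ·) ?_
  calc ∑ x, 𝔼 y with y ∈ atom B x, g y
      = ∑ x, ∑ y with y ∈ atom B x, (#{z | z ∈ atom B y} : ℚ≥0)⁻¹ • g y := by
        refine sum_congr rfl fun x _ => ?_
        rw [expect, smul_sum]
        refine sum_congr rfl fun y hy => ?_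
        rw [atom_eq_of_mem (mem_filter.1 hy).2]
    _ = ∑ y, ∑ x with x ∈ atom B y, (#{z | z ∈ atom B y} : ℚ≥0)⁻¹ • g y :=
        sum_comm' fun x y => by simp [mem_atom_comm]
    _ = ∑ y, g y := by
        refine sum_congr rfl fun y _ => ?_
        have hcard : (#{z | z ∈ atom B y} : ℚ≥0) ≠ 0 :=
          Nat.cast_ne_zero.2 (card_ne_zero.2 ⟨y, by simpa using mem_atom_self B y⟩)
        rw [sum_const, ← Nat.cast_smul_eq_nsmul ℚ≥0, smul_smul, mul_inv_cancel₀ hcard, one_smul]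

theorem expect_condExpect_mul {𝕜 : Type*} [RCLike 𝕜] (f : V n → ℝ) {h : V n → 𝕜}
    (hh : ConstOnAtoms B h) : 𝔼 x, (condExpect f B x : 𝕜) * h x = 𝔼 x, (f x : 𝕜) * h x := by
  classical
  rw [← expect_expect_atom B fun x => (f x : 𝕜) * h x]
  refine expect_congr rfl fun x _ => ?_
  rw [condExpect, RCLike.ofReal_expect, expect_mul]
  refine expect_congr rfl fun y hy => ?_
  rw [hh x y (mem_filter.1 hy).2]

theorem abs_condExpect_le {f : V n → ℝ} {R : ℝ} (hf : ∀ x, |f x| ≤ R)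
    (B : MeasurableSpace (V n)) (x : V n) : |condExpect f B x| ≤ R :=
  (abs_expect_le _ _).trans
    (expect_le ⟨x, by simpa using mem_atom_self B x⟩ fun y _ => hf y)

/-- The energy of `f` with respect to `B`, the squared `L²` norm of `𝔼(f | B)`. It increases under
refinement of `B`. -/
def energy (f : V n → ℝ) (B : MeasurableSpace (V n)) : ℝ := 𝔼 x, condExpect f B x ^ 2

theorem energy_nonneg (f : V n → ℝ) (B : MeasurableSpace (V n)) : 0 ≤ energy f B :=
  expect_nonneg fun _ _ => sq_nonneg _

theorem energy_le_one {f : V n → ℝ} (hf : ∀ x, |f x| ≤ 1) (B : MeasurableSpace (V n)) :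
    energy f B ≤ 1 :=
  expect_le univ_nonempty fun x _ => (sq_le_one_iff_abs_le_one _).2 (abs_condExpect_le hf B x)

theorem expect_condExpect_sub_sq (f : V n → ℝ) (h : Refines B' B) :
    𝔼 x, (condExpect f B' x - condExpect f B x) ^ 2 = energy f B' - energy f B := by
  have hconst := constOnAtoms_condExpect f B
  have hcross : 𝔼 x, condExpect f B' x * condExpect f B x = energy f B := by
    simp only [energy, sq]
    exact (expect_condExpect_mul f (hconst.mono h)).trans (expect_condExpect_mul f hconst).symm
  calc 𝔼 x, (condExpect f B' x - condExpect f B x) ^ 2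
      = 𝔼 x, (condExpect f B' x ^ 2 - 2 * (condExpect f B' x * condExpect f B x)
          + condExpect f B x ^ 2) := expect_congr rfl fun x _ => by ring
    _ = energy f B' - 2 * energy f B + energy f B := by
        rw [expect_add_distrib, expect_sub_distrib, ← mul_expect, hcross, energy, energy]
    _ = energy f B' - energy f B := by ring

end Factor

/-! ### The energy increment argument -/

section QuadraticFactor

variable {n : ℕ}

theorem refines_generatedFactor {ι κ : Type} {φ : ι → V n → ZMod 5} {ψ : κ → V n → ZMod 5}
    (h : ∀ k, ∃ i, ψ k = φ i) : Refines (generatedFactor φ) (generatedFactor ψ) := by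
  refine fun x => ⟨x, ?_⟩
  rw [atom_generatedFactor, atom_generatedFactor]
  intro y hy k
  obtain ⟨i, hi⟩ := h k
  rw [hi]
  exact hy i

theorem IsQuadraticFactor.exists_adjoin_quadPhase {B₁ B₂ : MeasurableSpace (V n)} {k₁ k₂ : ℕ}
    (hB : IsQuadraticFactor B₁ B₂ k₁ k₂) {M : Matrix (Fin n) (Fin n) (ZMod 5)} (hM : M.IsSymm)
    (r : V n) :
    ∃ B₁' B₂', IsQuadraticFactor B₁' B₂' (k₁ + 1) (k₂ + 1) ∧
      Refines B₁' B₁ ∧ Refines B₂' B₂ ∧ ConstOnAtoms B₂' (quadPhase M r) := by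
  obtain ⟨s, Q, hQ, rfl, rfl⟩ := hB
  refine ⟨_, _, ⟨Fin.snoc (α := fun _ => V n) s r,
    Fin.snoc (α := fun _ => Matrix (Fin n) (Fin n) (ZMod 5)) Q M, ?_, rfl, rfl⟩, ?_, ?_, ?_⟩
  · refine Fin.lastCases ?_ fun j => ?_
    · simpa only [Fin.snoc_last] using hM
    · simpa only [Fin.snoc_castSucc] using hQ j
  · exact refines_generatedFactor fun j => ⟨j.castSucc, by simp⟩
  · rintro x
    refine refines_generatedFactor ?_ x
    rintro (j | j)
    · exact ⟨Sum.inl j.castSucc, by simp⟩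
    · exact ⟨Sum.inr j.castSucc, by simp⟩
  · intro x y hy
    rw [atom_generatedFactor] at hy
    have hlinear := hy (Sum.inl (Fin.last _))
    have hquadratic := hy (Sum.inr (Fin.last _))
    simp only [Sum.elim_inl, Sum.elim_inr, Fin.snoc_last] at hlinear hquadratic
    rw [quadPhase, quadPhase, hlinear, hquadratic]

/-- The pair `B` is a quadratic factor of complexity at most `(d, d)` refining the pair `A`. A
single parameter `d` bounds both complexities, as this is what the iteration keeps track of. -/
def IsQuadraticRefinement (A B : MeasurableSpace (V n) × MeasurableSpace (V n)) (d : ℕ) : Prop :=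
  IsQuadraticFactorAtMost B.1 B.2 d d ∧ Refines B.1 A.1 ∧ Refines B.2 A.2

variable {A B C : MeasurableSpace (V n) × MeasurableSpace (V n)} {d e : ℕ}

theorem IsQuadraticFactorAtMost.isQuadraticRefinement_self
    (h : IsQuadraticFactorAtMost A.1 A.2 d d) : IsQuadraticRefinement A A d :=
  ⟨h, Refines.refl _, Refines.refl _⟩

theorem IsQuadraticRefinement.trans (hC : IsQuadraticRefinement B C e)
    (hB : IsQuadraticRefinement A B d) : IsQuadraticRefinement A C e :=
  ⟨hC.1, hC.2.1.trans hB.2.1, hC.2.2.trans hB.2.2⟩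

theorem IsQuadraticRefinement.mono (h : IsQuadraticRefinement A B d) (hde : d ≤ e) :
    IsQuadraticRefinement A B e := by
  obtain ⟨⟨k₁, hk₁, k₂, hk₂, hB⟩, hrefines⟩ := h
  exact ⟨⟨k₁, hk₁.trans hde, k₂, hk₂.trans hde, hB⟩, hrefines⟩

theorem sq_norm_expect_mul_le_energy_sub (f : V n → ℝ) {B B' : MeasurableSpace (V n)}
    (h : Refines B' B) {φ : V n → ℂ} (hφ : ConstOnAtoms B' φ) (hnorm : ∀ x, ‖φ x‖ ≤ 1) :
    ‖𝔼 x, ((f - condExpect f B) x : ℂ) * φ x‖ ^ 2 ≤ energy f B' - energy f B := by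
  have hproj : 𝔼 x, ((f - condExpect f B) x : ℂ) * φ x =
      𝔼 x, ((condExpect f B' x - condExpect f B x : ℝ) : ℂ) * φ x := by
    simp only [Pi.sub_apply, Complex.ofReal_sub, sub_mul, expect_sub_distrib]
    congr 1
    exact (expect_condExpect_mul f hφ).symm
  rw [hproj, ← expect_condExpect_sub_sq f h]
  refine (norm_expect_sq_le _).trans (expect_le_expect fun x _ => ?_)
  rw [norm_mul, mul_pow, Complex.norm_real, Real.norm_eq_abs, sq_abs]
  exact mul_le_of_le_one_right (sq_nonneg _) (pow_le_one₀ (norm_nonneg _) (hnorm x))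

end QuadraticFactor

theorem exists_energy_increment {ε : ℝ} (hε : 0 < ε) :
    ∃ c : ℝ, 0 < c ∧ ∀ (n : ℕ) (f : V n → ℝ), (∀ x, |f x| ≤ 1) →
      ∀ (B : MeasurableSpace (V n) × MeasurableSpace (V n)) (k : ℕ),
        IsQuadraticFactorAtMost B.1 B.2 k k → ε ≤ u3Norm (f - condExpect f B.2) →
        ∃ B', IsQuadraticRefinement B B' (k + 1) ∧ energy f B.2 + c ≤ energy f B'.2 := by
  obtain ⟨η, hη, hinverse⟩ := exists_quadPhase_correlation hε two_pos
  refine ⟨η ^ 2, by positivity, fun n f hf B k ⟨k₁, hk₁, k₂, hk₂, hB⟩ hu3 => ?_⟩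
  have hbound (x : V n) : |(f - condExpect f B.2) x| ≤ 2 :=
    (abs_sub _ _).trans (by linarith [hf x, abs_condExpect_le hf B.2 x])
  obtain ⟨M, hM, r, hcorr⟩ := hinverse n _ hbound hu3
  obtain ⟨B₁', B₂', hB', hrefines₁, hrefines₂, hconst⟩ := hB.exists_adjoin_quadPhase hM r
  refine ⟨(B₁', B₂'), ⟨⟨_, Nat.succ_le_succ hk₁, _, Nat.succ_le_succ hk₂, hB'⟩,
    hrefines₁, hrefines₂⟩, ?_⟩
  have hgain := sq_norm_expect_mul_le_energy_sub f hrefines₂ hconst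
    fun x => (norm_quadPhase M r x).le
  linarith [pow_le_pow_left₀ hη.le hcorr 2]

theorem exists_stage_of_forall_or_increment {α : Type*} {E : α → ℝ} (hnonneg : ∀ a, 0 ≤ E a)
    (hone : ∀ a, E a ≤ 1) {c : ℝ} {m : ℕ} (hm : 1 < m * c) {P Q : ℕ → α → Prop} {a₀ : α}
    (hzero : P 0 a₀) (hstep : ∀ i a, P i a → Q i a ∨ ∃ b, P (i + 1) b ∧ E a + c ≤ E b) :
    ∃ i < m, ∃ a, P i a ∧ Q i a := by
  by_contra! hfail
  have hgrow : ∀ i ≤ m, ∃ a, P i a ∧ i * c ≤ E a := by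
    intro i
    induction i with
    | zero => exact fun _ => ⟨a₀, hzero, by simpa using hnonneg a₀⟩
    | succ i ih =>
      intro hi
      obtain ⟨a, hPa, ha⟩ := ih (by lia)
      obtain ⟨b, hPb, hb⟩ := (hstep i a hPa).resolve_left (hfail i hi a hPa)
      exact ⟨b, hPb, by push_cast; linarith⟩
  obtain ⟨a, -, ha⟩ := hgrow m le_rfl
  linarith [hone a]

theorem exists_refinement_u3Norm_le {ε : ℝ} (hε : 0 < ε) :
    ∃ m : ℕ, ∀ (n : ℕ) (f : V n → ℝ), (∀ x, |f x| ≤ 1) →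
      ∀ (B : MeasurableSpace (V n) × MeasurableSpace (V n)) (k : ℕ),
        IsQuadraticFactorAtMost B.1 B.2 k k →
        ∃ B', IsQuadraticRefinement B B' (k + m) ∧ u3Norm (f - condExpect f B'.2) ≤ ε := by
  obtain ⟨c, hc, hincrement⟩ := exists_energy_increment hε
  obtain ⟨m, hm⟩ := exists_nat_gt (1 / c)
  refine ⟨m, fun n f hf B k hB => ?_⟩
  have hstep (i : ℕ) (C : MeasurableSpace (V n) × MeasurableSpace (V n))
      (hC : IsQuadraticRefinement B C (k + i)) :
      u3Norm (f - condExpect f C.2) ≤ ε ∨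
        ∃ D, IsQuadraticRefinement B D (k + (i + 1)) ∧ energy f C.2 + c ≤ energy f D.2 := by
    refine or_iff_not_imp_left.2 fun hlarge => ?_
    obtain ⟨D, hD, henergy⟩ := hincrement n f hf C (k + i) hC.1 (not_le.1 hlarge).le
    exact ⟨D, hD.trans hC, henergy⟩
  obtain ⟨i, hi, C, hC, hu3⟩ := exists_stage_of_forall_or_increment
    (fun _ => energy_nonneg f _) (fun _ => energy_le_one hf _) ((div_lt_iff₀ hc).1 hm)
    hB.isQuadraticRefinement_self hstep
  exact ⟨C, hC.mono (by lia), hu3⟩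

theorem exists_nested_refinements {δ : ℝ} (hδ : 0 < δ) {ε : ℕ → ℝ} (hε : ∀ d, 0 < ε d) (k : ℕ) :
    ∃ C : ℕ, ∀ (n : ℕ) (f : V n → ℝ), (∀ x, |f x| ≤ 1) →
      ∀ A : MeasurableSpace (V n) × MeasurableSpace (V n), IsQuadraticFactorAtMost A.1 A.2 k k →
        ∃ d ≤ C, ∃ B, IsQuadraticRefinement A B d ∧ ∃ D : MeasurableSpace (V n),
          l2Norm (condExpect f D - condExpect f B.2) ≤ δ ∧ u3Norm (f - condExpect f D) ≤ ε d := by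
  choose m hm using fun d => exists_refinement_u3Norm_le (hε d)
  let K (i : ℕ) : ℕ := (fun d => d + m d)^[i] k
  have hK (i : ℕ) : K (i + 1) = K i + m (K i) := Function.iterate_succ_apply' _ i k
  have hK_mono : Monotone K := monotone_nat_of_le_succ fun i => (hK i).symm ▸ Nat.le_add_right _ _
  obtain ⟨T, hT⟩ := exists_nat_gt (1 / δ ^ 2)
  refine ⟨K T, fun n f hf A hA => ?_⟩
  have hstep (i : ℕ) (B : MeasurableSpace (V n) × MeasurableSpace (V n))
      (hB : IsQuadraticRefinement A B (K i)) :
      (∃ D : MeasurableSpace (V n), l2Norm (condExpect f D - condExpect f B.2) ≤ δ ∧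
          u3Norm (f - condExpect f D) ≤ ε (K i)) ∨
        ∃ D, IsQuadraticRefinement A D (K (i + 1)) ∧ energy f B.2 + δ ^ 2 ≤ energy f D.2 := by
    obtain ⟨D, hD, hu3⟩ := hm (K i) n f hf B (K i) hB.1
    refine or_iff_not_imp_left.2 fun hfail => ⟨D, hK i ▸ hD.trans hB, ?_⟩
    have hl2 : δ < l2Norm (condExpect f D.2 - condExpect f B.2) :=
      lt_of_not_ge fun h => hfail ⟨D.2, h, hu3⟩
    have hgain := (Real.lt_sqrt hδ.le).1 hl2
    simp only [Pi.sub_apply, expect_condExpect_sub_sq f hD.2.2] at hgain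
    linarith
  obtain ⟨i, hi, B, hB, hD⟩ := exists_stage_of_forall_or_increment
    (fun _ => energy_nonneg f _) (fun _ => energy_le_one hf _)
    ((div_lt_iff₀ (sq_pos_of_pos hδ)).1 hT) hA.isQuadraticRefinement_self hstep
  exact ⟨K i, hK_mono hi.le, B, hB, hD⟩

end QuadFourier

end

theorem mainTheorem4 (δ : ℝ) (hδ : 0 < δ) (ω : ℝ → ℝ) (hω : ∀ t, 0 ≤ t → 0 < ω t)
    (d₁ d₂ : ℕ) :
    ∃ C : ℕ, ∀ (n : ℕ) (f : QuadFourier.V n → ℝ), (∀ x, f x ∈ Set.Icc (-1 : ℝ) 1) →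
      ∀ A₁ A₂ : MeasurableSpace (QuadFourier.V n),
        QuadFourier.IsQuadraticFactor A₁ A₂ d₁ d₂ →
        ∃ d ≤ C, ∃ B₁ B₂ : MeasurableSpace (QuadFourier.V n),
          QuadFourier.IsQuadraticFactorAtMost B₁ B₂ d d ∧
          QuadFourier.Refines B₁ A₁ ∧ QuadFourier.Refines B₂ A₂ ∧
          ∃ f₁ f₂ f₃ : QuadFourier.V n → ℝ,
            f = f₁ + f₂ + f₃ ∧
            f₁ = QuadFourier.condExpect f B₂ ∧
            QuadFourier.l2Norm f₂ ≤ δ ∧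
            QuadFourier.u3Norm f₃ ≤ 1 / ω d := by
  obtain ⟨C, hC⟩ := QuadFourier.exists_nested_refinements hδ (ε := fun d => 1 / ω d)
    (fun d => one_div_pos.2 (hω d d.cast_nonneg)) (max d₁ d₂)
  refine ⟨C, fun n f hf A₁ A₂ hA => ?_⟩
  obtain ⟨d, hd, ⟨B₁, B₂⟩, ⟨hB, hB₁, hB₂⟩, D, hl2, hu3⟩ := hC n f (fun x => abs_le.2 (hf x))
    (A₁, A₂) ⟨d₁, le_max_left _ _, d₂, le_max_right _ _, hA⟩
  exact ⟨d, hd, B₁, B₂, hB, hB₁, hB₂, _, _, _, by abel, rfl, hl2, hu3⟩
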